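/- **Theorem 8.2.** Let $\sigma_0$ be a finite relational vocabulary all of whose symbols are unary or binary. Let $\mathscr{C}_0$ be a free amalgamation class of finite $\sigma_0$-structures, i.e. a nonempty class of finite structures closed under isomorphism and substructures such that, for all embeddings $M\hookrightarrow N$ and $M\hookrightarrow P$ between members of $\mathscr{C}_0$, the free amalgam of $N$ and $P$ over $M$ (the disjoint union of $N$ and $P$ glued along $M$, with no relations other than those of $N$ and of $P$) again belongs to $\mathscr{C}_0$. Assume that all structures in $\mathscr{C}_0$ are irreflexive: $R(x,x)$ never holds for a binary $R\in\sigma_0$. Let $\mathscr{C}$ be the class of all $(\sigma_0\uplus\{<\})$-structures obtained from structures in $\mathscr{C}_0$ by interpreting $<$ as an arbitrary strict total order, and let $\mathbb{A}$ be the Fraïssé limit of $\mathscr{C}$, i.e. the countable homogeneous structure whose finite substructures are, up to isomorphism, exactly the members of $\mathscr{C}$. Let $S\subset\mathbb{A}$ be finite, let $\operatorname{Aut}(\mathbb{A}/S)$ be the group of automorphisms of $\mathbb{A}$ fixing every element of $S$, and let $I$ be a finite totally ordered set. Let $\mathcal{O}\subseteq\mathbb{A}^I$ be an $S$-ordered orbit,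 i.e. $\mathcal{O}=\operatorname{Aut}(\mathbb{A}/S)\cdot o$ for a tuple $o\in\mathbb{A}^I$ with $o_i\notin S$ for all $i\in I$ and $o_i<o_j$ whenever $i<j$. Let $\mathbb{F}$ be a field, $n\ge 0$, and $\mathbb{E}$ a linear subspace of $\mathbb{F}^n$. Let $\operatorname{Lin}_{\mathbb{E}}\mathcal{O}$ be the space of finite formal linear combinations of elements of $\mathcal{O}$ with coefficients in $\mathbb{E}$, i.e. of finitely supported functions $v:\mathcal{O}\to\mathbb{E}$. For $i\in I$ let $v\mapsto v|^{-i}$ be the linear map on $\operatorname{Lin}_{\mathbb{E}}\mathcal{O}$ induced by deleting the $i$-th coordinate, $$v|^{-i}(a)=\sum_{b\in\mathcal{O},\; b|_{I\setminus\{i\}}=a} v(b)\qquad(a\in\mathbb{A}^{I\setminus\{i\}}).$$ A vector $v\in\operatorname{Lin}_{\mathbb{E}}\mathcal{O}$ is *balanced* if $v|^{-i}=0$ for all $i\in I$. An *$\mathcal{O}$-duo* $a\parallel b$ consists of $a,b\in\mathcal{O}$ such that $a_i<b_i$ for all $i\in I$; $b_i<a_j$ for all $i<j$ in $I$; and for every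 binary $R\in\sigma_0$ and all $i,j\in I$, $$R(a_i,b_j)\iff R(a_i,a_j)\iff R(b_i,b_j)\iff R(b_i,a_j).$$ For an $\mathcal{O}$-duo $a\parallel b$ and $\lambda\in\mathbb{E}$, put $$\lambda\cdot (a\between b)=\sum_{J\subseteq I}(-1)^{|J|}\lambda\cdot\bigl(a|^{I\setminus J}\,b|^{J}\bigr)\in\operatorname{Lin}_{\mathbb{E}}\mathcal{O},$$ where $a|^{I\setminus J}\,b|^{J}$ is the tuple with $i$-th entry $b_i$ for $i\in J$ and $a_i$ for $i\in I\setminus J$. Then every balanced vector $v\in\operatorname{Lin}_{\mathbb{E}}\mathcal{O}$ can be written as a finite sum $$v=\sum_{a\parallel b}\lambda_{a\parallel b}\cdot(a\between b)$$ over $\mathcal{O}$-duos $a\parallel b$, with coefficients $\lambda_{a\parallel b}\in\mathbb{E}$. -/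

import Mathlib

universe u v w

namespace OrderedFreeAmalg

open scoped FirstOrder

section Classes

/-- The relation symbols of the vocabulary `{<}`: a single binary symbol. -/
inductive LtRel : ℕ → Type
  | lt : LtRel 2

/-- The vocabulary `{<}`. -/
def ltLang : FirstOrder.Language.{0, 0} := ⟨fun _ => Empty, LtRel⟩

instance : ltLang.IsRelational := fun _ => inferInstanceAs (IsEmpty Empty)

/-- The symbol `<` of the vocabulary `{<}`. -/
def ltSymb : ltLang.Relations 2 := LtRel.lt

/-- The vocabulary `σ = σ₀ ⊎ {<}`. -/
abbrev ordLang (L : FirstOrder.Language.{u, v}) : FirstOrder.Language.{u, v} := L.sum ltLang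

variable {L : FirstOrder.Language.{u, v}}

/-- `R(x, y)` in a `(σ₀ ⊎ {<})`-structure, for a binary symbol `R` of `σ₀`. -/
def Rel {A : Type w} [(ordLang L).Structure A] (R : L.Relations 2) (x y : A) : Prop :=
  FirstOrder.Language.Structure.RelMap
    ((FirstOrder.Language.LHom.sumInl : L →ᴸ ordLang L).onRelation R) ![x, y]

variable (L) in
/-- `x < y` in a `(σ₀ ⊎ {<})`-structure. -/
def Lt {A : Type w} [(ordLang L).Structure A] (x y : A) : Prop :=
  FirstOrder.Language.Structure.RelMap
    ((FirstOrder.Language.LHom.sumInr : ltLang →ᴸ ordLang L).onRelation ltSymb) ![x, y]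

/-- The `σ₀`-reduct of a `(σ₀ ⊎ {<})`-structure. -/
def reduct (M : CategoryTheory.Bundled.{w} (ordLang L).Structure) :
    CategoryTheory.Bundled.{w} L.Structure :=
  ⟨M, (FirstOrder.Language.LHom.sumInl : L →ᴸ ordLang L).reduct M⟩

/-- The square `M → N → Q`, `M → P → Q` exhibits `Q` as the free amalgam of `N` and `P` over `M`:
it commutes, `Q` is the union of the images of `N` and `P`, these images overlap only in the image
of `M`, and each tuple related in `Q` lies within the image of `N` or within the image of `P`. -/
structure IsFreeAmalgam {M N P Q : Type w} [L.Structure M] [L.Structure N] [L.Structure P]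
    [L.Structure Q] (MN : M ↪[L] N) (MP : M ↪[L] P) (NQ : N ↪[L] Q) (PQ : P ↪[L] Q) : Prop where
  comm : ∀ m : M, NQ (MN m) = PQ (MP m)
  cover : ∀ q : Q, q ∈ Set.range NQ ∨ q ∈ Set.range PQ
  overlap : ∀ (x : N) (y : P), NQ x = PQ y → ∃ m : M, x = MN m ∧ y = MP m
  rel : ∀ (n : ℕ) (R : L.Relations n) (t : Fin n → Q), FirstOrder.Language.Structure.RelMap R t →
    (∀ i, t i ∈ Set.range NQ) ∨ (∀ i, t i ∈ Set.range PQ)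

/-- A free amalgamation class of finite structures over a relational vocabulary: a nonempty class
of finite structures, closed under isomorphic copies and substructures (together: `Hereditary`),
and such that any two of its members have their free amalgam over any common substructure in the
class. (The joint embedding property is the case of the empty common substructure.) -/
structure IsFreeAmalgamationClass (K : Set (CategoryTheory.Bundled.{w} L.Structure)) : Prop where
  nonempty : K.Nonempty
  finite : ∀ M ∈ K, Finite M
  hereditary : FirstOrder.Language.Hereditary K
  free_amalgamation : ∀ (M N P : CategoryTheory.Bundled.{w} L.Structure)
    (MN : M ↪[L] N) (MP : M ↪[L] P), M ∈ K → N ∈ K → P ∈ K →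
    ∃ Q ∈ K, ∃ (NQ : N ↪[L] Q) (PQ : P ↪[L] Q), IsFreeAmalgam MN MP NQ PQ

/-- All structures of the class interpret all binary relation symbols as irreflexive relations. -/
def IsIrreflexiveClass (K : Set (CategoryTheory.Bundled.{w} L.Structure)) : Prop :=
  ∀ M ∈ K, ∀ (R : L.Relations 2) (x : M), ¬ FirstOrder.Language.Structure.RelMap R ![x, x]

/-- The class of all total orderings of all structures in `K`. -/
def orderedExpansion (K : Set (CategoryTheory.Bundled.{w} L.Structure)) :
    Set (CategoryTheory.Bundled.{w} (ordLang L).Structure) :=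
  {M | reduct M ∈ K ∧ IsStrictTotalOrder M (Lt L (A := M))}

end Classes

section Orbits

variable (L : FirstOrder.Language.{u, v}) {A : Type w} [(ordLang L).Structure A] {I : Type*}

/-- The orbit `Aut(A/S) · o` of a tuple `o`, where `Aut(A/S)` consists of the automorphisms of `A`
that fix every element of `S`. -/
def orbit (S : Finset A) (o : I → A) : Set (I → A) :=
  {a | ∃ π : A ≃[ordLang L] A, (∀ s ∈ S, π s = s) ∧ ∀ i, a i = π (o i)}

/-- A tuple is `S`-ordered if no entry lies in `S` and the entries are strictly increasing. -/
def IsOrderedTuple [LinearOrder I] (S : Finset A) (a : I → A) : Prop :=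
  (∀ i, a i ∉ S) ∧ ∀ i j, i < j → Lt L (a i) (a j)

/-- An `S`-ordered orbit: the `Aut(A/S)`-orbit of an `S`-ordered tuple. -/
def IsOrderedOrbit [LinearOrder I] (S : Finset A) (O : Set (I → A)) : Prop :=
  ∃ o : I → A, IsOrderedTuple L S o ∧ O = orbit L S o

/-- `a ∥ b` is an `O`-duo. -/
structure IsDuo [LinearOrder I] (O : Set (I → A)) (a b : I → A) : Prop where
  left_mem : a ∈ O
  right_mem : b ∈ O
  lt_same : ∀ i, Lt L (a i) (b i)
  lt_next : ∀ i j, i < j → Lt L (b i) (a j)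
  rel_ab : ∀ (R : L.Relations 2) (i j : I), Rel R (a i) (b j) ↔ Rel R (a i) (a j)
  rel_bb : ∀ (R : L.Relations 2) (i j : I), Rel R (a i) (a j) ↔ Rel R (b i) (b j)
  rel_ba : ∀ (R : L.Relations 2) (i j : I), Rel R (b i) (b j) ↔ Rel R (b i) (a j)

end Orbits

section Vectors

variable {A I : Type*} (F : Type*) [Field F] (E : Type*) [AddCommGroup E] [Module F E]

/-- `Lin_E O`: finite formal linear combinations of elements of `O` with coefficients in `E`,
realised as the finitely supported functions `A^I → E` that vanish outside of `O`. -/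
def Lin (O : Set (I → A)) : Submodule F ((I → A) →₀ E) :=
  Finsupp.supported E F O

/-- The linear map `v ↦ v|^J` induced by restricting `I`-tuples to `J ⊆ I`. It sums the
coefficients over each fibre of the restriction, and sends `Lin_E O` into `Lin_E (O|^J)`. -/
noncomputable def proj (J : Set I) : ((I → A) →₀ E) →ₗ[F] ((J → A) →₀ E) :=
  Finsupp.lmapDomain E F (fun (a : I → A) (j : J) => a j)

/-- The balanced vectors `BLin_E O`: the vectors of `Lin_E O` in the kernel of all the maps
`v ↦ v|^{I ∖ {i}}`, for `i ∈ I`. -/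
noncomputable def BLin (O : Set (I → A)) : Submodule F ((I → A) →₀ E) :=
  Lin F E O ⊓ ⨅ i : I, LinearMap.ker (proj F E ({i}ᶜ : Set I))

variable {E}

/-- The formal expression `l · (a ≬ b) = ∑_{J ⊆ I} (-1)^|J| l · (a|^{I ∖ J} b|^J)`. -/
noncomputable def cog [Fintype I] [DecidableEq I] (a b : I → A) (l : E) : (I → A) →₀ E :=
  ∑ J : Finset I, Finsupp.single (J.piecewise b a) ((-1 : ℤ) ^ J.card • l)

end Vectors

end OrderedFreeAmalg

-- Let only the coordinates in `J ⊆ I` vary, the others being fixed, and induct on `J`. Cutting a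
-- vector balanced over `J` by its value at `i ∈ J` gives pieces balanced over `J \ {i}`; hence, for
-- every `i ∈ J`, the vector is a combination of cogs that vary exactly in `J \ {i}`
-- (`mem_cogSpan_slice`). When the constant entry at `i` of such a cog is replaced by a suitable new
-- point, old minus new is a cog varying in all of `J` (`mapDomain_move_sub_mem`). So replacing the
-- coordinates in `J` one after the other changes the vector only by cogs over `J`. The last one, `m
-- = max J`, is replaced by the same point in all tuples; the outcome depends only on the projection
-- forgetting `m`, so it is zero, and the vector itself is a combination of cogs.
--
-- The new points come from free amalgamation (`exists_isShift`). To a finite set `T` containing all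
-- entries in play, add a copy of `T` for each coordinate, every point of it just above its
-- original, and one further point, the apex, which replaces the entries at `m`. A copy is related
-- to `T` like its original, but copies for `i` and `j` are related only if `i ≠ j` and they look
-- like `o i` and `o j`; the apex is related only to parameters and to copies for `i` that have the
-- type of `o i` over the parameters. Every clique of this structure maps back into `A`: copies go
-- to their originals if the apex is absent, and to the `o i` if it is present
-- (`exists_map_of_clique`). A free amalgamation class contains each finite structure whose cliques
-- it contains (`IsFreeAmalgamationClass.mem_of_cliques`), the order is arbitrary, and homogeneity
-- realises the extension over `T` (`hasRealizations`).

universe x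

namespace OrderedFreeAmalg

/-! ### Cogs varying in some of the coordinates, and the induction on these coordinates. -/

section PartialCogs

variable {A I E : Type*} [AddCommGroup E]

/-- A duo in the set `D` of tuples whose two members differ exactly at the coordinates in `J`: the
members are related by `N` there, and all tuples obtained by mixing them lie in `D`. -/
structure PartialDuo (D : Set (I → A)) (N : A → A → Prop) (J : Finset I) (a b : I → A) :
    Prop where
  mix : ∀ t : I → A, (∀ i, t i = a i ∨ t i = b i) → t ∈ D
  off : ∀ i ∉ J, a i = b i
  on : ∀ i ∈ J, N (a i) (b i)

theorem PartialDuo.mono {D D' : Set (I → A)} (h : D ⊆ D') {N : A → A → Prop} {J : Finset I}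
    {a b : I → A} (hab : PartialDuo D N J a b) : PartialDuo D' N J a b :=
  ⟨fun t ht => h (hab.mix t ht), hab.off, hab.on⟩

variable [DecidableEq I]

/-- The alternating sum over all ways to replace coordinates in `J` of `a` by those of `b`. -/
noncomputable def partialCog (J : Finset I) (a b : I → A) (l : E) : (I → A) →₀ E :=
  ∑ K ∈ J.powerset, Finsupp.single (K.piecewise b a) ((-1 : ℤ) ^ K.card • l)

variable (E) in
/-- The span of the formal expressions of all partial duos. -/
noncomputable def cogSpan (D : Set (I → A)) (N : A → A → Prop) (J : Finset I) : AddSubgroup ((I → A) →₀ E) :=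
  AddSubgroup.closure {w | ∃ a b l, PartialDuo D N J a b ∧ w = partialCog J a b l}

/-- Apply `f i` to the `i`-th coordinate, for all `i ∈ K`. -/
def move (f : I → A → A) (K : Finset I) (t : I → A) : I → A :=
  K.piecewise (fun i => f i (t i)) t

theorem cogSpan_mono {D D' : Set (I → A)} (h : D ⊆ D') (N : A → A → Prop) (J : Finset I) :
    cogSpan E D N J ≤ cogSpan E D' N J := by
  refine AddSubgroup.closure_mono ?_
  rintro w ⟨a, b, l, hab, rfl⟩
  exact ⟨a, b, l, hab.mono h, rfl⟩

/-- A combination involves finitely many tuples. The finiteness of `T` matters because only finite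
extensions can be realised in the limit. -/
theorem exists_finset_mem_cogSpan [Fintype I] {D : Set (I → A)} {N : A → A → Prop} {J : Finset I}
    {w : (I → A) →₀ E} (hw : w ∈ cogSpan E D N J) :
    ∃ T : Finset A, w ∈ cogSpan E (D ∩ {t | ∀ i, t i ∈ T}) N J := by
  classical
  have key : ∀ T T' : Finset A, T ⊆ T' →
      cogSpan E (D ∩ {t | ∀ i, t i ∈ T}) N J ≤ cogSpan E (D ∩ {t | ∀ i, t i ∈ T'}) N J :=
    fun T T' h => cogSpan_mono (Set.inter_subset_inter_right D
      fun t (ht : ∀ i, t i ∈ T) i => h (ht i)) N J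
  induction hw using AddSubgroup.closure_induction with
  | mem w hw =>
    obtain ⟨a, b, l, hab, rfl⟩ := hw
    refine ⟨Finset.univ.image a ∪ Finset.univ.image b, AddSubgroup.subset_closure
      ⟨a, b, l, ⟨fun t ht => ⟨hab.mix t ht, fun i => ?_⟩, hab.off, hab.on⟩, rfl⟩⟩
    rcases ht i with h | h <;> simp [h]
  | zero => exact ⟨∅, zero_mem _⟩
  | add x y _ _ hx hy =>
    obtain ⟨T, hT⟩ := hx
    obtain ⟨T', hT'⟩ := hy
    exact ⟨T ∪ T', add_mem (key _ _ Finset.subset_union_left hT)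
      (key _ _ Finset.subset_union_right hT')⟩
  | neg x _ hx =>
    obtain ⟨T, hT⟩ := hx
    exact ⟨T, neg_mem hT⟩

/-- The subsets of `insert i J` are split by whether they contain `i`; those that do carry an
additional sign. -/
theorem partialCog_insert {J : Finset I} {i : I} (hi : i ∉ J) (a b a' b' a'' b'' : I → A) (l : E)
    (h' : ∀ K ⊆ J, K.piecewise b a = K.piecewise b' a')
    (h'' : ∀ K ⊆ J, (insert i K).piecewise b a = K.piecewise b'' a'') :
    partialCog (insert i J) a b l = partialCog J a' b' l - partialCog J a'' b'' l := by
  unfold partialCog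
  rw [Finset.sum_powerset_insert hi, sub_eq_add_neg, ← Finset.sum_neg_distrib]
  refine congrArg₂ _ (Finset.sum_congr rfl fun K hK => ?_) (Finset.sum_congr rfl fun K hK => ?_)
  · rw [h' K (Finset.mem_powerset.1 hK)]
  · rw [h'' K (Finset.mem_powerset.1 hK), Finset.card_insert_of_notMem
      fun h => hi (Finset.mem_powerset.1 hK h), ← Finsupp.single_neg, pow_succ]
    simp

theorem mapDomain_partialCog (g : (I → A) → I → A) (J : Finset I) (a b a' b' : I → A) (l : E)
    (h : ∀ K ⊆ J, g (K.piecewise b a) = K.piecewise b' a') :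
    Finsupp.mapDomain g (partialCog J a b l) = partialCog J a' b' l := by
  unfold partialCog
  rw [Finsupp.mapDomain_finsetSum]
  refine Finset.sum_congr rfl fun K hK => ?_
  rw [Finsupp.mapDomain_single, h K (Finset.mem_powerset.1 hK)]

theorem move_piecewise (f : I → A → A) (K K' : Finset I) (a b : I → A) :
    move f K (K'.piecewise b a) = K'.piecewise (move f K b) (move f K a) := by
  funext j
  by_cases h : j ∈ K <;> by_cases h' : j ∈ K' <;> simp [move, Finset.piecewise, h, h']

/-- Moving the coordinate `i` as well changes a combination of partial duos that are constant at `i`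
by a combination of partial duos that also vary at `i`. -/
theorem mapDomain_move_sub_mem {D D' : Set (I → A)} {N : A → A → Prop} {J K : Finset I} {i : I}
    (hi : i ∈ J) (hK : i ∉ K) (f : I → A → A)
    (h₀ : ∀ t ∈ D, move f K t ∈ D') (h₁ : ∀ t ∈ D, move f (insert i K) t ∈ D')
    (h₂ : ∀ t ∈ D, N (t i) (f i (t i)))
    (h₃ : ∀ t ∈ D, ∀ t' ∈ D, ∀ j ∈ J.erase i, N (t j) (t' j) → N (move f K t j) (move f K t' j))
    {w : (I → A) →₀ E} (hw : w ∈ cogSpan E D N (J.erase i)) :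
    Finsupp.mapDomain (move f K) w - Finsupp.mapDomain (move f (insert i K)) w ∈
      cogSpan E D' N J := by
  induction hw using AddSubgroup.closure_induction with
  | mem w hw =>
    obtain ⟨a, b, l, hab, rfl⟩ := hw
    have ha : a ∈ D := hab.mix a fun i => Or.inl rfl
    have hb : b ∈ D := hab.mix b fun i => Or.inr rfl
    have hab_i : a i = b i := hab.off i (by simp)
    refine AddSubgroup.subset_closure ⟨move f K a, move f (insert i K) b, l, ⟨?_, ?_, ?_⟩, ?_⟩
    · intro t ht
      -- A mix `t` of the new members comes from a mix `s` of `a` and `b`: away from `i`, moving `K`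
      -- and moving `insert i K` have the same effect, and the entry at `i` decides whether `t` is
      -- `move f K s` or `move f (insert i K) s`.
      have hex : ∀ j, ∃ y, (y = a j ∨ y = b j) ∧
          (j ≠ i → t j = if j ∈ K then f j y else y) := by
        intro j
        rcases ht j with h | h
        · refine ⟨a j, Or.inl rfl, fun _ => ?_⟩
          simp [h, move, Finset.piecewise]
        · refine ⟨b j, Or.inr rfl, fun hj => ?_⟩
          simp [h, move, Finset.piecewise, hj]
      choose s hs hst using hex
      have hsD : s ∈ D := hab.mix s hs
      have hsi : s i = a i := by rcases hs i with h | h <;> simp [h, hab_i]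
      rcases ht i with h | h
      · convert h₀ s hsD using 1
        funext j
        by_cases hj : j = i
        · subst hj
          simp [h, move, Finset.piecewise, hK, hsi]
        · simp [hst j hj, move, Finset.piecewise]
      · convert h₁ s hsD using 1
        funext j
        by_cases hj : j = i
        · subst hj
          simp [h, move, Finset.piecewise, hsi, hab_i]
        · simp [hst j hj, move, Finset.piecewise, hj]
    · intro j hj
      have hji : j ≠ i := fun h => hj (h ▸ hi)
      have := hab.off j fun h => hj (Finset.mem_of_mem_erase h)
      simp [move, Finset.piecewise, hji, this]
    · intro j hj
      by_cases hji : j = i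
      · subst hji
        simpa [move, Finset.piecewise, hK, hab_i] using h₂ b hb
      · have hj' : j ∈ J.erase i := Finset.mem_erase.2 ⟨hji, hj⟩
        have := h₃ a ha b hb j hj' (hab.on j hj')
        simpa [move, Finset.piecewise, hji] using this
    · rw [mapDomain_partialCog _ _ a b _ _ l fun K' _ => move_piecewise f K K' a b,
        mapDomain_partialCog _ _ a b _ _ l fun K' _ => move_piecewise f (insert i K) K' a b]
      conv_rhs => rw [← Finset.insert_erase hi]
      refine (partialCog_insert (Finset.notMem_erase i J) _ _ _ _ _ _ l ?_ ?_).symm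
      · intro K' hK'
        have hiK' : i ∉ K' := fun h => Finset.notMem_erase i J (hK' h)
        funext j
        by_cases hj : j ∈ K'
        · have hji : j ≠ i := fun h => hiK' (h ▸ hj)
          simp [move, Finset.piecewise, hj, hji]
        · simp [Finset.piecewise, hj]
      · intro K' hK'
        funext j
        by_cases hji : j = i
        · subst hji
          simp [move, Finset.piecewise, hab_i]
        · by_cases hj : j ∈ K' <;> simp [move, Finset.piecewise, hj, hji]
  | zero => simp
  | add x y _ _ hx hy =>
    rw [Finsupp.mapDomain_add, Finsupp.mapDomain_add, add_sub_add_comm]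
    exact add_mem hx hy
  | neg x _ hx =>
    have : ∀ g : (I → A) → I → A, Finsupp.mapDomain g (-x) = -Finsupp.mapDomain g x :=
      fun g => map_neg (Finsupp.mapDomain.addMonoidHom g) x
    rw [this, this, neg_sub_neg, ← neg_sub]
    exact neg_mem hx

/-- A family of maps that moves every coordinate in `J`, the coordinate `m` last and to a constant,
and keeps tuples of `D` in `D'` on the way. -/
structure IsShift (D D' : Set (I → A)) (N : A → A → Prop) (J : Finset I) (m : I)
    (f : I → A → A) : Prop where
  move_mem : ∀ t ∈ D, ∀ K ⊆ J.erase m, move f K t ∈ D'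
  move_all_mem : ∀ t ∈ D, move f J t ∈ D'
  rel : ∀ t ∈ D, ∀ i ∈ J, N (t i) (f i (t i))
  map_rel : ∀ t ∈ D, ∀ t' ∈ D, ∀ i ∈ J.erase m, N (t i) (t' i) → N (f i (t i)) (f i (t' i))
  const : ∀ x y, f m x = f m y

/-- The difference telescopes over the coordinates moved one at a time. The coordinate `m` comes
last: once it is moved, membership in `D'` is guaranteed only if all of `J` is moved. -/
theorem IsShift.sub_mapDomain_move_mem {D D' : Set (I → A)} {N : A → A → Prop} {J : Finset I}
    {m : I} {f : I → A → A} (hf : IsShift D D' N J m f) (hm : m ∈ J) {v : (I → A) →₀ E}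
    (hv : ∀ i ∈ J, v ∈ cogSpan E D N (J.erase i)) :
    v - Finsupp.mapDomain (move f J) v ∈ cogSpan E D' N J := by
  have h₃ : ∀ K ⊆ J.erase m, ∀ i, ∀ t ∈ D, ∀ t' ∈ D, ∀ j ∈ J.erase i,
      N (t j) (t' j) → N (move f K t j) (move f K t' j) := by
    intro K hK i t ht t' ht' j _ hN
    by_cases hj : j ∈ K
    · simpa [move, Finset.piecewise, hj] using hf.map_rel t ht t' ht' j (hK hj) hN
    · simpa [move, Finset.piecewise, hj] using hN
  have key : ∀ K ⊆ J.erase m, v - Finsupp.mapDomain (move f K) v ∈ cogSpan E D' N J := by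
    intro K
    induction K using Finset.induction_on with
    | empty =>
      intro _
      have : move f ∅ = id := by
        funext t
        simp [move]
      rw [this, Finsupp.mapDomain_id, sub_self]
      exact zero_mem _
    | insert i K hi ih =>
      intro hK
      have hKs : K ⊆ J.erase m := (Finset.subset_insert i K).trans hK
      have hiJ : i ∈ J := Finset.mem_of_mem_erase (hK (Finset.mem_insert_self i K))
      rw [← sub_add_sub_cancel v (Finsupp.mapDomain (move f K) v)]
      exact add_mem (ih hKs) (mapDomain_move_sub_mem hiJ hi f (fun t ht => hf.move_mem t ht K hKs)
        (fun t ht => hf.move_mem t ht _ hK) (fun t ht => hf.rel t ht i hiJ) (h₃ K hKs i)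
        (hv i hiJ))
  rw [← sub_add_sub_cancel v (Finsupp.mapDomain (move f (J.erase m)) v)]
  refine add_mem (key _ subset_rfl) ?_
  have := mapDomain_move_sub_mem hm (Finset.notMem_erase m J) f
    (fun t ht => hf.move_mem t ht _ subset_rfl)
    (fun t ht => by rw [Finset.insert_erase hm]; exact hf.move_all_mem t ht)
    (fun t ht => hf.rel t ht m hm) (h₃ _ subset_rfl m) (hv m hm)
  rwa [Finset.insert_erase hm] at this

/-- Forget the coordinate `i`. -/
def forget (i : I) (a : I → A) : ({i}ᶜ : Set I) → A := fun j => a j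

/-- The entry at `m` is overwritten by a constant, so `move f J` factors through `forget m`. -/
theorem IsShift.mapDomain_move_eq_zero {D D' : Set (I → A)} {N : A → A → Prop} {J : Finset I}
    {m : I} {f : I → A → A} (hf : IsShift D D' N J m f) (hm : m ∈ J) {v : (I → A) →₀ E}
    (hv : Finsupp.mapDomain (forget m) v = 0) : Finsupp.mapDomain (move f J) v = 0 := by
  rcases isEmpty_or_nonempty A with hA | ⟨⟨x⟩⟩
  · have : IsEmpty (I → A) := ⟨fun a => hA.false (a m)⟩
    exact Subsingleton.elim _ _
  -- The point `x` is an arbitrary filler at `m`, overwritten by the constant.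
  have : move f J = (fun a : ({m}ᶜ : Set I) → A => move f J fun i =>
      if h : i = m then x else a ⟨i, h⟩) ∘ forget m := by
    funext t i
    by_cases him : i = m
    · subst him
      simp [move, Finset.piecewise, hm, hf.const (t i) x]
    · simp [move, Finset.piecewise, him, forget]
  rw [this, Finsupp.mapDomain_comp, hv, Finsupp.mapDomain_zero]

/-- The tuples of `O` that agree with `o` off `J`. -/
def slice (O : Set (I → A)) (J : Finset I) (o : I → A) : Set (I → A) :=
  {t | t ∈ O ∧ ∀ j ∉ J, t j = o j}

theorem mapDomain_filter_comp {X Y : Type*} (g : X → Y) (p : Y → Prop) [DecidablePred p]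
    (v : X →₀ E) :
    Finsupp.mapDomain g (v.filter fun x => p (g x)) = (Finsupp.mapDomain g v).filter p := by
  induction v using Finsupp.induction_linear with
  | zero => rw [Finsupp.filter_zero, Finsupp.mapDomain_zero, Finsupp.filter_zero]
  | add x y hx hy => simp [Finsupp.filter_add, Finsupp.mapDomain_add, hx, hy]
  | single a b =>
    by_cases h : p (g a)
    · simp [Finsupp.mapDomain_single, Finsupp.filter_single_of_pos, h]
    · simp [Finsupp.mapDomain_single, Finsupp.filter_single_of_neg, h]

/-- If balanced vectors can be shifted freely, they are combinations of partial duos. -/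
theorem mem_cogSpan_slice [LinearOrder I] [Fintype I] {O : Set (I → A)} {N : A → A → Prop}
    (hshift : ∀ o ∈ O, ∀ (J : Finset I) (hJ : J.Nonempty) (T : Finset A), ∃ f : I → A → A,
      IsShift (slice O J o ∩ {t | ∀ i, t i ∈ T}) (slice O J o) N J (J.max' hJ) f)
    (J : Finset I) : ∀ o ∈ O, ∀ v : (I → A) →₀ E, (∀ t ∈ v.support, t ∈ slice O J o) →
      (∀ i ∈ J, Finsupp.mapDomain (forget i) v = 0) → v ∈ cogSpan E (slice O J o) N J := by
  classical
  induction J using Finset.strongInduction with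
  | H J ih =>
  intro o ho v hv hbal
  rcases J.eq_empty_or_nonempty with rfl | hJ
  · have hsupp : v.support ⊆ {o} := fun t ht =>
      Finset.mem_singleton.2 (funext fun j => (hv t ht).2 j (by simp))
    rw [Finsupp.support_subset_singleton.1 hsupp]
    refine AddSubgroup.subset_closure ⟨o, o, v o, ⟨fun t ht => ?_, fun _ _ => rfl, by simp⟩, ?_⟩
    · have : t = o := funext fun i => by simpa using ht i
      exact ⟨this ▸ ho, fun j _ => by rw [this]⟩
    · simp [partialCog]
  -- Each fibre of `t ↦ t i` on the support lies in a smaller slice based at a tuple `o'` of the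
  -- support, which is why the induction quantifies over the base.
  have hspan : ∀ i ∈ J, v ∈ cogSpan E (slice O J o) N (J.erase i) := by
    intro i hi
    have hsum : v = ∑ c ∈ v.support.image (fun t => t i), v.filter fun t => t i = c := by
      ext t
      rw [Finsupp.finsetSum_apply]
      by_cases ht : v t = 0
      · rw [ht, Finset.sum_eq_zero]
        intro c _
        by_cases h : t i = c <;> simp [h, ht]
      · rw [Finset.sum_eq_single (t i)]
        · simp
        · intro c _ hc
          simp [hc.symm]
        · intro h
          exact absurd (Finset.mem_image_of_mem _ (Finsupp.mem_support_iff.2 ht)) h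
    rw [hsum]
    refine sum_mem fun c hc => ?_
    obtain ⟨o', ho', rfl⟩ := Finset.mem_image.1 hc
    have ho'D := hv o' ho'
    refine cogSpan_mono ?_ N _ (ih (J.erase i) (Finset.erase_ssubset hi) o' ho'D.1
      (v.filter fun t => t i = o' i) ?_ ?_)
    · rintro t ⟨htO, ht⟩
      refine ⟨htO, fun j hj => ?_⟩
      rw [ht j fun h => hj (Finset.mem_of_mem_erase h), ho'D.2 j hj]
    · intro t ht
      rw [Finsupp.support_filter, Finset.mem_filter] at ht
      refine ⟨(hv t ht.1).1, fun j hj => ?_⟩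
      by_cases hji : j = i
      · rw [hji, ht.2]
      · have hjJ : j ∉ J := fun h => hj (Finset.mem_erase.2 ⟨hji, h⟩)
        rw [(hv t ht.1).2 j hjJ, ho'D.2 j hjJ]
    · intro k hk
      have hki : k ≠ i := Finset.ne_of_mem_erase hk
      -- Forgetting `k ≠ i` keeps the coordinate `i`, so it commutes with the cut and the piece
      -- stays balanced.
      have := mapDomain_filter_comp (forget k)
        (fun a : ({k}ᶜ : Set I) → A => a ⟨i, hki.symm⟩ = o' i) v
      rw [hbal k (Finset.mem_of_mem_erase hk), Finsupp.filter_zero] at this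
      exact this
  have hT : ∀ i : J, ∃ T : Finset A,
      v ∈ cogSpan E (slice O J o ∩ {t | ∀ i, t i ∈ T}) N (J.erase i) :=
    fun i => exists_finset_mem_cogSpan (hspan i i.2)
  choose T hT using hT
  obtain ⟨f, hf⟩ := hshift o ho J hJ (Finset.univ.biUnion T)
  have hm : J.max' hJ ∈ J := J.max'_mem hJ
  have hvT : ∀ i ∈ J, v ∈ cogSpan E (slice O J o ∩ {t | ∀ i, t i ∈ Finset.univ.biUnion T}) N
      (J.erase i) := by
    intro i hi
    refine cogSpan_mono ?_ N _ (hT ⟨i, hi⟩)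
    rintro t ⟨htO, ht⟩
    exact ⟨htO, fun j => Finset.mem_biUnion.2 ⟨⟨i, hi⟩, Finset.mem_univ _, ht j⟩⟩
  have := hf.sub_mapDomain_move_mem hm hvT
  rwa [hf.mapDomain_move_eq_zero hm (hbal _ hm), sub_zero] at this

end PartialCogs

end OrderedFreeAmalg

namespace OrderedFreeAmalg

/-! ### Extensions by copies and an apex, and the shifts obtained from them. -/

section Shifts

variable {A : Type u} {I : Type v} {α β : Type*} [LinearOrder A] [LinearOrder I]
  (U : α → A → Prop) (B : β → A → A → Prop)

omit [LinearOrder I] in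
/-- The tuples `o` and `a` have the same quantifier-free type over `S`, where `U` and `B` are the
unary and the binary relations besides the order. -/
structure SameType (S : Set A) (o a : I → A) : Prop where
  unary : ∀ p i, U p (a i) ↔ U p (o i)
  binary : ∀ R i j, B R (a i) (a j) ↔ B R (o i) (o j)
  lt : ∀ i j, a i < a j ↔ o i < o j
  left : ∀ R, ∀ s ∈ S, ∀ i, B R s (a i) ↔ B R s (o i)
  right : ∀ R, ∀ s ∈ S, ∀ i, B R (a i) s ↔ B R (o i) s
  lt_left : ∀ s ∈ S, ∀ i, s < a i ↔ s < o i
  lt_right : ∀ s ∈ S, ∀ i, a i < s ↔ o i < s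

/-- Every finite extension `X` of a finite part `T` of `A` is realised in `A` over `T`, provided that
each set of pairwise related points of `X` is a copy of a set of points of `A`. -/
def HasRealizations : Prop :=
  ∀ (X : Type w) [Finite X] [LinearOrder X] (u : α → X → Prop) (r : β → X → X → Prop)
    (T : Finset A) (s : T → X),
    (∀ R x, ¬ r R x x) → (∀ p x, u p (s x) ↔ U p x) → (∀ R x y, r R (s x) (s y) ↔ B R x y) →
    StrictMono s →
    (∀ Q : Set X, (∀ x ∈ Q, ∀ y ∈ Q, x ≠ y → ∃ R, r R x y ∨ r R y x) →
      ∃ h : X → A, (∀ p, ∀ x ∈ Q, U p (h x) ↔ u p x) ∧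
        ∀ R, ∀ x ∈ Q, ∀ y ∈ Q, x ≠ y → (B R (h x) (h y) ↔ r R x y)) →
    ∃ g : X → A, StrictMono g ∧ (∀ x : T, g (s x) = x) ∧ (∀ p x, U p (g x) ↔ u p x) ∧
      ∀ R x y, B R (g x) (g y) ↔ r R x y

/-- `x` lies below `y`, and no relation holds between them. -/
def FreeLt (x y : A) : Prop := x < y ∧ ∀ R, ¬ B R x y ∧ ¬ B R y x

/-- The points `some (none, x)` (the old points), `some (some i, x)` (copies of them for each
coordinate `i`), and `none` (the apex). -/
abbrev Ext (T : Finset A) (I : Type*) := Option (Option I × T)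

/-- The binary relations between `x` and `y` are those between `o i` and `o j`. -/
def Agree (o : I → A) (i j : I) (x y : A) : Prop :=
  ∀ R, (B R x y ↔ B R (o i) (o j)) ∧ (B R y x ↔ B R (o j) (o i))

/-- The relations of `x` with itself and with `S` are those of `z`. -/
def SameTypeAt (S : Set A) (z x : A) : Prop :=
  (∀ p, U p x ↔ U p z) ∧ ∀ R, ∀ s ∈ S, (B R x s ↔ B R z s) ∧ (B R s x ↔ B R s z)

/-- The unary relations on the extension. -/
def extUnary (T : Finset A) (o : I → A) (m : I) (p : α) : Ext T I → Prop
  | none => U p (o m)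
  | some (_, x) => U p x

/-- The binary relations on the extension: the apex behaves like `o m` towards `S` and towards the
copies, and copies for different coordinates `i` and `j` are related only like `o i` and `o j`. -/
def extRel (T : Finset A) (S : Set A) (o : I → A) (m : I) (R : β) : Ext T I → Ext T I → Prop
  | none, none => False
  | none, some (none, y) => B R (o m) y ∧ (y : A) ∈ S
  | none, some (some j, y) => B R (o m) (o j) ∧ SameTypeAt U B S (o j) y
  | some (none, x), none => B R x (o m) ∧ (x : A) ∈ S
  | some (some i, x), none => B R (o i) (o m) ∧ SameTypeAt U B S (o i) x
  | some (some i, x), some (some j, y) => B R x y ∧ i ≠ j ∧ Agree B o i j x y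
  | some (none, x), some (_, y) => B R x y
  | some (some _, x), some (none, y) => B R x y

/-- The points of `A` that are below the apex: those below every point of `S` above `z`. -/
def lowerPart (S : Set A) (z : A) : Set A := {x | ∀ s ∈ S, z < s → x < s}

open Classical in
/-- The position of a point of the extension in the order: each copy is just above the old point,
and the apex is just above the lower part. -/
noncomputable def extKey (T : Finset A) (S : Set A) (z : A) : Ext T I → ℕ ×ₗ A ×ₗ WithBot I
  | none => toLex (1, toLex (z, ⊥))
  | some (c, x) => toLex (if (x : A) ∈ lowerPart S z then 0 else 2, toLex ((x : A), c))

omit [LinearOrder I] in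
theorem extKey_injective (T : Finset A) (S : Set A) (z : A) :
    Function.Injective (extKey T S z : Ext T I → _) := by
  rintro (_ | ⟨c, x⟩) (_ | ⟨d, y⟩) h
  · rfl
  · simp only [extKey, toLex_inj, Prod.mk.injEq] at h
    split_ifs at h <;> simp at h
  · simp only [extKey, toLex_inj, Prod.mk.injEq] at h
    split_ifs at h <;> simp at h
  · simp only [extKey, toLex_inj, Prod.mk.injEq] at h
    have h1 : x = y := Subtype.ext (congrArg Prod.fst h.2)
    have h2 : c = d := congrArg Prod.snd h.2
    rw [h1, h2]

/-- The order on the extension. -/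
noncomputable abbrev extOrder (T : Finset A) (S : Set A) (z : A) : LinearOrder (Ext T I) :=
  LinearOrder.lift' (extKey T S z) (extKey_injective T S z)

theorem extOrder_lt_of_lt {T : Finset A} {S : Set A} {z : A} {x y : T} (h : (x : A) < y)
    (c d : Option I) : (extOrder T S z).lt (some (c, x)) (some (d, y)) := by
  change (extKey T S z _ : ℕ ×ₗ A ×ₗ WithBot I) < extKey T S z _
  simp only [extKey, Prod.Lex.toLex_lt_toLex]
  by_cases hy : (y : A) ∈ lowerPart S z
  · have hx : (x : A) ∈ lowerPart S z := fun s hs hzs => h.trans (hy s hs hzs)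
    simp [hx, hy, h]
  · by_cases hx : (x : A) ∈ lowerPart S z <;> simp [hx, hy, h]

theorem extOrder_old_lt_copy {T : Finset A} {S : Set A} {z : A} (x : T) (i : I) :
    (extOrder T S z).lt (some (none, x)) (some (some i, x)) := by
  change (extKey T S z _ : ℕ ×ₗ A ×ₗ WithBot I) < extKey T S z _
  simp only [extKey, Prod.Lex.toLex_lt_toLex]
  exact Or.inr ⟨trivial, Or.inr ⟨trivial, WithBot.bot_lt_coe i⟩⟩

theorem extOrder_lt_apex {T : Finset A} {S : Set A} {z : A} {x : T}
    (h : (x : A) ∈ lowerPart S z) (c : Option I) : (extOrder T S z).lt (some (c, x)) none := by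
  change (extKey T S z _ : ℕ ×ₗ A ×ₗ WithBot I) < extKey T S z _
  simp [extKey, Prod.Lex.toLex_lt_toLex, h]

theorem extOrder_apex_lt {T : Finset A} {S : Set A} {z : A} {x : T}
    (h : (x : A) ∉ lowerPart S z) (c : Option I) : (extOrder T S z).lt none (some (c, x)) := by
  change (extKey T S z _ : ℕ ×ₗ A ×ₗ WithBot I) < extKey T S z _
  simp [extKey, Prod.Lex.toLex_lt_toLex, h]

variable {U B}

omit [LinearOrder A] [LinearOrder I] in
theorem extRel_irrefl (hirr : ∀ R x, ¬ B R x x) (T : Finset A) (S : Set A) (o : I → A) (m : I)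
    (R : β) (x : Ext T I) : ¬ extRel U B T S o m R x x := by
  rcases x with _ | ⟨_ | i, x⟩ <;> simp [extRel, hirr]

omit [LinearOrder A] [LinearOrder I] in
-- The side conditions in `extRel` hold for every pair of distinct related points, hence throughout
-- a clique. With the apex present, old points are parameters and copies for `i` have the type of `o
-- i`, so apex and copies can be sent to `o m` and the `o i`. Without it, each copy can be sent to
-- its original.
theorem exists_map_of_clique (T : Finset A) (S : Set A) (o : I → A) (m : I) (Q : Set (Ext T I))
    (hQ : ∀ x ∈ Q, ∀ y ∈ Q, x ≠ y → ∃ R, extRel U B T S o m R x y ∨ extRel U B T S o m R y x) :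
    ∃ h : Ext T I → A, (∀ p, ∀ x ∈ Q, U p (h x) ↔ extUnary U T o m p x) ∧
      ∀ R, ∀ x ∈ Q, ∀ y ∈ Q, x ≠ y → (B R (h x) (h y) ↔ extRel U B T S o m R x y) := by
  have hagree : ∀ i x j y, some (some i, x) ∈ Q → some (some j, y) ∈ Q →
      (some (some i, x) : Ext T I) ≠ some (some j, y) → i ≠ j ∧ Agree B o i j x y := by
    intro i x j y hx hy hne
    obtain ⟨R, h | h⟩ := hQ _ hx _ hy hne
    · exact h.2
    · exact ⟨h.2.1.symm, fun R => (h.2.2 R).symm⟩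
  by_cases hapex : none ∈ Q
  · have hold : ∀ x, some (none, x) ∈ Q → (x : A) ∈ S := by
      intro x hx
      obtain ⟨R, h | h⟩ := hQ _ hx _ hapex (by simp)
      · exact h.2
      · exact h.2
    have hcopy : ∀ i x, some (some i, x) ∈ Q → SameTypeAt U B S (o i) (x : A) := by
      intro i x hx
      obtain ⟨R, h | h⟩ := hQ _ hx _ hapex (by simp)
      · exact h.2
      · exact h.2
    refine ⟨fun
      | none => o m
      | some (none, x) => x
      | some (some i, _) => o i, ?_, ?_⟩
    · rintro p (_ | ⟨_ | i, x⟩) hx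
      · exact Iff.rfl
      · exact Iff.rfl
      · exact ((hcopy i x hx).1 p).symm
    · rintro R (_ | ⟨_ | i, x⟩) hx (_ | ⟨_ | j, y⟩) hy hne
      · exact absurd rfl hne
      · exact (and_iff_left (hold y hy)).symm
      · exact (and_iff_left (hcopy j y hy)).symm
      · exact (and_iff_left (hold x hx)).symm
      · exact Iff.rfl
      · exact (((hcopy j y hy).2 R x (hold x hx)).2).symm
      · exact (and_iff_left (hcopy i x hx)).symm
      · exact (((hcopy i x hx).2 R y (hold y hy)).1).symm
      · have := hagree i x j y hx hy hne
        exact ((this.2 R).1).symm.trans (and_iff_left this).symm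
  · refine ⟨fun
      | none => o m
      | some (_, x) => x, ?_, ?_⟩
    · rintro p (_ | ⟨c, x⟩) hx
      · exact Iff.rfl
      · exact Iff.rfl
    · rintro R (_ | ⟨_ | i, x⟩) hx (_ | ⟨_ | j, y⟩) hy hne
      · exact absurd hx hapex
      · exact absurd hx hapex
      · exact absurd hx hapex
      · exact absurd hy hapex
      · exact Iff.rfl
      · exact Iff.rfl
      · exact absurd hy hapex
      · exact Iff.rfl
      · exact (and_iff_left (hagree i x j y hx hy hne)).symm

theorem SameType.strictMono {S : Set A} {o t : I → A} (h : SameType U B S o t)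
    (ho : StrictMono o) : StrictMono t :=
  fun i j hij => (h.lt i j).2 (ho hij)

omit [LinearOrder I] in
theorem SameType.notMem {S : Set A} {o t : I → A} (h : SameType U B S o t)
    (hoS : ∀ i, o i ∉ S) (i : I) : t i ∉ S := by
  intro hi
  have h1 := h.lt_left _ hi i
  have h2 := h.lt_right _ hi i
  simp only [lt_self_iff_false, false_iff, not_lt] at h1 h2
  exact hoS i (le_antisymm h2 h1 ▸ hi)

omit [LinearOrder I] in
theorem SameType.trans {S : Set A} {o t t' : I → A} (h : SameType U B S o t)
    (h' : SameType U B S t t') : SameType U B S o t' where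
  unary p i := (h'.unary p i).trans (h.unary p i)
  binary R i j := (h'.binary R i j).trans (h.binary R i j)
  lt i j := (h'.lt i j).trans (h.lt i j)
  left R s hs i := (h'.left R s hs i).trans (h.left R s hs i)
  right R s hs i := (h'.right R s hs i).trans (h.right R s hs i)
  lt_left s hs i := (h'.lt_left s hs i).trans (h.lt_left s hs i)
  lt_right s hs i := (h'.lt_right s hs i).trans (h.lt_right s hs i)

omit [LinearOrder I] in
theorem SameType.symm {S : Set A} {o t : I → A} (h : SameType U B S o t) :
    SameType U B S t o where
  unary p i := (h.unary p i).symm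
  binary R i j := (h.binary R i j).symm
  lt i j := (h.lt i j).symm
  left R s hs i := (h.left R s hs i).symm
  right R s hs i := (h.right R s hs i).symm
  lt_left s hs i := (h.lt_left s hs i).symm
  lt_right s hs i := (h.lt_right s hs i).symm

/-- Over a large enough finite set `T`, all the coordinates in `J` can be shifted. -/
theorem exists_isShift (hirr : ∀ R x, ¬ B R x x) [Finite I]
    (hreal : HasRealizations.{u, max u v} U B)
    {S : Set A} {o : I → A} (ho : StrictMono o) (hoS : ∀ i, o i ∉ S) (J : Finset I)
    (hJ : J.Nonempty) (T : Finset A) (hST : ∀ s ∈ S, s ∈ T) (hoT : ∀ i, o i ∈ T) :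
    ∃ f : I → A → A, IsShift (slice {t | SameType U B S o t} J o ∩ {t | ∀ i, t i ∈ T})
      (slice {t | SameType U B S o t} J o) (FreeLt B) J (J.max' hJ) f := by
  classical
  set m := J.max' hJ
  have hmJ : m ∈ J := J.max'_mem hJ
  -- Coordinates off `J` are constant along the slice, so they act as further parameters.
  set S' : Set A := S ∪ {x | ∃ j ∉ J, x = o j}
  have homS' : o m ∉ S' := by
    rintro (h | ⟨j, hj, h⟩)
    · exact hoS m h
    · exact hj (ho.injective h ▸ hmJ)
  have hlow : ∀ s ∈ S', s ∈ lowerPart S' (o m) ↔ s < o m := by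
    intro s hs
    refine ⟨fun h => ?_, fun h s' _ hs' => h.trans hs'⟩
    by_contra hle
    rcases (not_lt.1 hle).lt_or_eq with h' | h'
    · exact lt_irrefl _ (h s hs h')
    · exact homS' (h' ▸ hs)
  let _ : LinearOrder (Ext T I) := extOrder T S' (o m)
  obtain ⟨g, hg, hgT, hgU, hgB⟩ := hreal (Ext T I) (extUnary U T o m) (extRel U B T S' o m) T
    (fun x => some (none, x)) (extRel_irrefl hirr T S' o m) (fun _ _ => Iff.rfl)
    (fun _ _ _ => Iff.rfl) (fun x y hxy => extOrder_lt_of_lt hxy none none)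
    (exists_map_of_clique T S' o m)
  set D := slice {t | SameType U B S o t} J o ∩ {t | ∀ i, t i ∈ T}
  have hinj : ∀ t ∈ D, Function.Injective t := fun t ht => (ht.1.1.strictMono ho).injective
  have htS' : ∀ t ∈ D, ∀ i ∈ J, t i ∉ S' := by
    rintro t ht i hi (h | ⟨j, hj, h⟩)
    · exact ht.1.1.notMem hoS i h
    · rw [← ht.1.2 j hj] at h
      exact hj (hinj t ht h ▸ hi)
  have hoff : ∀ t ∈ D, ∀ j ∉ J, t j ∈ S' := fun t ht j hj => Or.inr ⟨j, hj, ht.1.2 j hj⟩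
  -- This is where the apex has to replace the largest coordinate of `J`: entries at `i ≤ m` are at
  -- most `t m`, hence below all parameters above `o m`, so they end up below the apex.
  have htlow : ∀ t ∈ D, ∀ i ≤ m, t i ∈ lowerPart S' (o m) := by
    rintro t ht i hi s hs hos
    refine ((ht.1.1.strictMono ho).monotone hi).trans_lt ?_
    rcases hs with hs | ⟨j, hj, rfl⟩
    · exact (ht.1.1.lt_right s hs m).2 hos
    · rw [← ht.1.2 j hj]
      exact (ht.1.1.lt m j).2 hos
  have hagree : ∀ t ∈ D, ∀ i j, Agree B o i j (t i) (t j) :=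
    fun t ht i j R => ⟨ht.1.1.binary R i j, ht.1.1.binary R j i⟩
  have hat : ∀ t ∈ D, ∀ i, SameTypeAt U B S' (o i) (t i) := by
    intro t ht i
    refine ⟨fun p => ht.1.1.unary p i, ?_⟩
    rintro R s (hs | ⟨j, hj, rfl⟩)
    · exact ⟨ht.1.1.right R s hs i, ht.1.1.left R s hs i⟩
    · have := hagree t ht i j R
      rwa [ht.1.2 j hj] at this
  -- The value outside `T` is irrelevant, since the tuples considered have all their entries in `T`.
  let f : I → A → A := fun i x =>
    if i = m then g none else if h : x ∈ T then g (some (some i, ⟨x, h⟩)) else x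
  have hfm : ∀ x, f m x = g none := fun x => by simp [f]
  have hf : ∀ i ≠ m, ∀ x (hx : x ∈ T), f i x = g (some (some i, ⟨x, hx⟩)) := by
    intro i hi x hx
    simp [f, hi, hx]
  -- moved tuples are realised by points of the extension
  have hmove : ∀ t ∈ D, ∀ K ⊆ J, (m ∈ K → K = J) →
      move f K t ∈ slice {t | SameType U B S o t} J o := by
    intro t ht K hKJ hmK
    refine ⟨?_, fun j hj => ?_⟩
    swap
    · have : j ∉ K := fun h => hj (hKJ h)
      simp [move, Finset.piecewise, this, ht.1.2 j hj]
    let τ : I → Ext T I := fun j =>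
      if j ∈ K then if j = m then none else some (some j, ⟨t j, ht.2 j⟩)
      else some (none, ⟨t j, ht.2 j⟩)
    have hτ : ∀ j, (j = m ∧ K = J ∧ τ j = none) ∨
        (j ≠ m ∧ j ∈ K ∧ τ j = some (some j, ⟨t j, ht.2 j⟩)) ∨
        (j ∉ K ∧ τ j = some (none, ⟨t j, ht.2 j⟩)) := by
      intro j
      by_cases hjK : j ∈ K
      · by_cases hjm : j = m
        · exact Or.inl ⟨hjm, hmK (hjm ▸ hjK), by simp [τ, hjm, hjm ▸ hjK]⟩
        · exact Or.inr (Or.inl ⟨hjm, hjK, by simp [τ, hjm, hjK]⟩)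
      · exact Or.inr (Or.inr ⟨hjK, by simp [τ, hjK]⟩)
    have hgτ : move f K t = g ∘ τ := by
      funext j
      by_cases hjK : j ∈ K
      · by_cases hjm : j = m
        · subst hjm
          simp [move, Finset.piecewise, τ, hjK, hfm]
        · simp [move, Finset.piecewise, τ, hjK, hjm, hf j hjm _ (ht.2 j)]
      · simp [move, Finset.piecewise, τ, hjK, hgT]
    have hmono : StrictMono τ := by
      intro i j hij
      have hlt : t i < t j := ht.1.1.strictMono ho hij
      rcases hτ i with ⟨rfl, hKJ', hi⟩ | hi
      -- Coordinates beyond `m = max J` are parameters above `o m`, and these lie above the apex.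
      · have hjJ : j ∉ J := fun h => (J.le_max' j h).not_gt hij
        rcases hτ j with ⟨rfl, _, _⟩ | ⟨_, hjK, _⟩ | ⟨_, hj⟩
        · exact absurd hij (lt_irrefl _)
        · exact absurd (hKJ hjK) hjJ
        · rw [hi, hj]
          refine extOrder_apex_lt (fun h => ?_) _
          rw [hlow _ (hoff t ht j hjJ)] at h
          change t j < o m at h
          rw [ht.1.2 j hjJ] at h
          exact (ho hij).not_gt h
      · obtain ⟨c, hi⟩ : ∃ c, τ i = some (c, ⟨t i, ht.2 i⟩) := by
          rcases hi with ⟨_, _, hi⟩ | ⟨_, hi⟩ <;> exact ⟨_, hi⟩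
        rcases hτ j with ⟨rfl, _, hj⟩ | ⟨_, _, hj⟩ | ⟨_, hj⟩
        · rw [hi, hj]
          exact extOrder_lt_apex (htlow t ht i hij.le) _
        · rw [hi, hj]
          exact extOrder_lt_of_lt hlt _ _
        · rw [hi, hj]
          exact extOrder_lt_of_lt hlt _ _
    have hgs : ∀ s (hs : s ∈ S), g (some (none, ⟨s, hST s hs⟩)) = s := fun s hs => hgT _
    have hne : ∀ s ∈ S, ∀ i, s ≠ t i := fun s hs i h => ht.1.1.notMem hoS i (h ▸ hs)
    have hSlt : ∀ s (hs : s ∈ S) i, (s < o i → (some (none, ⟨s, hST s hs⟩) : Ext T I) < τ i) ∧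
        (o i < s → τ i < (some (none, ⟨s, hST s hs⟩) : Ext T I)) := by
      intro s hs i
      rcases hτ i with ⟨rfl, _, hi⟩ | hi
      · rw [hi]
        refine ⟨fun h => extOrder_lt_apex ((hlow s (Or.inl hs)).2 h) _,
          fun h => extOrder_apex_lt (fun h' => ?_) _⟩
        exact h.not_gt ((hlow s (Or.inl hs)).1 h')
      · obtain ⟨c, hi⟩ : ∃ c, τ i = some (c, ⟨t i, ht.2 i⟩) := by
          rcases hi with ⟨_, _, hi⟩ | ⟨_, hi⟩ <;> exact ⟨_, hi⟩
        rw [hi, ← ht.1.1.lt_left s hs i, ← ht.1.1.lt_right s hs i]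
        exact ⟨fun h => extOrder_lt_of_lt h _ _, fun h => extOrder_lt_of_lt h _ _⟩
    change SameType U B S o (move f K t)
    rw [hgτ]
    constructor
    · intro p i
      rw [Function.comp_apply, hgU]
      rcases hτ i with ⟨rfl, _, hi⟩ | ⟨_, _, hi⟩ | ⟨_, hi⟩ <;> rw [hi]
      · exact Iff.rfl
      · exact ht.1.1.unary p i
      · exact ht.1.1.unary p i
    · intro R i j
      rw [Function.comp_apply, Function.comp_apply, hgB]
      by_cases hij : i = j
      · subst hij
        exact iff_of_false (extRel_irrefl hirr T S' o m R _) (hirr R _)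
      have hb := ht.1.1.binary R i j
      rcases hτ i with ⟨rfl, hK, hi⟩ | ⟨_, _, hi⟩ | ⟨hiK, hi⟩ <;>
        rcases hτ j with ⟨hjm, hK', hj⟩ | ⟨_, _, hj⟩ | ⟨hjK, hj⟩ <;> rw [hi, hj]
      · exact absurd hjm.symm hij
      · exact and_iff_left (hat t ht j)
      -- If the apex occurs then `K = J`, so an unmoved coordinate is a parameter, and the apex
      -- relates to it like `o m`.
      · rw [hK] at hjK
        refine (and_iff_left (hoff t ht j hjK)).trans ?_
        change B R (o m) (t j) ↔ _
        rw [ht.1.2 j hjK]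
      · subst hjm
        exact and_iff_left (hat t ht i)
      · exact (and_iff_left ⟨hij, hagree t ht i j⟩).trans hb
      · exact hb
      · subst hjm
        rw [hK'] at hiK
        refine (and_iff_left (hoff t ht i hiK)).trans ?_
        change B R (t i) (o m) ↔ _
        rw [ht.1.2 i hiK]
      · exact hb
      · exact hb
    · intro i j
      exact (hg.comp hmono).lt_iff_lt.trans ho.lt_iff_lt.symm
    · intro R s hs i
      rw [Function.comp_apply]
      conv_lhs => rw [← hgs s hs]
      rw [hgB]
      rcases hτ i with ⟨rfl, _, hi⟩ | ⟨_, _, hi⟩ | ⟨_, hi⟩ <;> rw [hi]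
      · exact and_iff_left (Or.inl hs)
      · exact ht.1.1.left R s hs i
      · exact ht.1.1.left R s hs i
    · intro R s hs i
      rw [Function.comp_apply]
      conv_lhs => rw [← hgs s hs]
      rw [hgB]
      rcases hτ i with ⟨rfl, _, hi⟩ | ⟨_, _, hi⟩ | ⟨_, hi⟩ <;> rw [hi]
      · exact and_iff_left (Or.inl hs)
      · exact ht.1.1.right R s hs i
      · exact ht.1.1.right R s hs i
    · intro s hs i
      rw [Function.comp_apply]
      conv_lhs => rw [← hgs s hs]
      rw [hg.lt_iff_lt]
      refine ⟨fun h => ?_, (hSlt s hs i).1⟩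
      by_contra hle
      rcases (not_lt.1 hle).lt_or_eq with h' | h'
      · exact lt_asymm h ((hSlt s hs i).2 h')
      · exact hoS i (h' ▸ hs)
    · intro s hs i
      rw [Function.comp_apply]
      conv_lhs => rw [← hgs s hs]
      rw [hg.lt_iff_lt]
      refine ⟨fun h => ?_, (hSlt s hs i).2⟩
      by_contra hle
      rcases (not_lt.1 hle).lt_or_eq with h' | h'
      · exact lt_asymm h ((hSlt s hs i).1 h')
      · exact hoS i (h' ▸ hs)
  refine ⟨f, fun t ht K hK => ?_, fun t ht => hmove t ht J subset_rfl fun _ => rfl, ?_, ?_,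
    fun x y => by rw [hfm, hfm]⟩
  · exact hmove t ht K (hK.trans (Finset.erase_subset _ _))
      fun h => absurd (hK h) (Finset.notMem_erase _ _)
  · intro t ht i hi
    have htg : t i = g (some (none, ⟨t i, ht.2 i⟩)) := (hgT ⟨t i, ht.2 i⟩).symm
    by_cases him : i = m
    · rw [him, hfm]
      rw [him] at htg hi
      refine ⟨?_, fun R => ?_⟩
      · rw [htg]
        exact hg (extOrder_lt_apex (htlow t ht m le_rfl) _)
      · rw [htg, hgB, hgB]
        exact ⟨fun h => htS' t ht m hi h.2, fun h => htS' t ht m hi h.2⟩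
    · rw [hf i him _ (ht.2 i)]
      refine ⟨?_, fun R => ?_⟩
      · conv_lhs => rw [htg]
        exact hg (extOrder_old_lt_copy _ _)
      -- A copy relates to its original as the original relates to itself, that is, not at all.
      · have h₁ := hgB R (some (none, ⟨t i, ht.2 i⟩)) (some (some i, ⟨t i, ht.2 i⟩))
        have h₂ := hgB R (some (some i, ⟨t i, ht.2 i⟩)) (some (none, ⟨t i, ht.2 i⟩))
        rw [hgT] at h₁ h₂
        exact ⟨fun h => hirr R _ (h₁.1 h), fun h => hirr R _ (h₂.1 h)⟩
  · intro t ht t' ht' i hi hN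
    rw [hf i (Finset.ne_of_mem_erase hi) _ (ht.2 i), hf i (Finset.ne_of_mem_erase hi) _ (ht'.2 i)]
    refine ⟨hg (extOrder_lt_of_lt hN.1 _ _), fun R => ?_⟩
    rw [hgB, hgB]
    -- Copies for the same coordinate are never related.
    exact ⟨fun h => h.2.1 rfl, fun h => h.2.1 rfl⟩

/-- Balanced vectors on a class of tuples of the same type are combinations of partial duos. -/
theorem mem_cogSpan_of_balanced {E : Type*} [AddCommGroup E] [Fintype I]
    (hirr : ∀ R x, ¬ B R x x) (hreal : HasRealizations.{u, max u v} U B) (S : Finset A)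
    {o : I → A} (ho : StrictMono o) (hoS : ∀ i, o i ∉ S) (v : (I → A) →₀ E)
    (hv : ∀ t ∈ v.support, SameType U B (S : Set A) o t)
    (hbal : ∀ i, Finsupp.mapDomain (forget i) v = 0) :
    v ∈ cogSpan E {t | SameType U B (S : Set A) o t} (FreeLt B) Finset.univ := by
  classical
  have h := mem_cogSpan_slice (E := E) (O := {t | SameType U B (S : Set A) o t}) (N := FreeLt B)
    (fun o' ho' J hJ T => ?_) Finset.univ o ⟨fun _ _ => Iff.rfl, fun _ _ _ => Iff.rfl,
      fun _ _ => Iff.rfl, fun _ _ _ _ => Iff.rfl, fun _ _ _ _ => Iff.rfl, fun _ _ _ => Iff.rfl,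
      fun _ _ _ => Iff.rfl⟩ v (fun t ht => ⟨hv t ht, by simp⟩) (fun i _ => hbal i)
  · exact cogSpan_mono (fun t ht => ht.1) _ _ h
  · have hO : {t | SameType U B (S : Set A) o t} = {t | SameType U B (S : Set A) o' t} :=
      Set.ext fun t => ⟨ho'.symm.trans, ho'.trans⟩
    -- `T` may be enlarged, since a shift over a larger set is also a shift over `T`.
    obtain ⟨f, hf⟩ := exists_isShift hirr hreal (ho'.strictMono ho) (ho'.notMem hoS) J hJ
      (T ∪ S ∪ Finset.univ.image o') (fun s hs => by simp [Finset.mem_coe.1 hs])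
      (fun i => by simp)
    rw [hO]
    have hsub : slice {t | SameType U B (S : Set A) o' t} J o' ∩ {t | ∀ i, t i ∈ T} ⊆
        slice {t | SameType U B (S : Set A) o' t} J o' ∩
          {t | ∀ i, t i ∈ T ∪ S ∪ Finset.univ.image o'} := by
      rintro t ⟨h1, h2⟩
      exact ⟨h1, fun i => by simp [h2 i]⟩
    exact ⟨f, fun t ht => hf.move_mem t (hsub ht), fun t ht => hf.move_all_mem t (hsub ht),
      fun t ht => hf.rel t (hsub ht), fun t ht t' ht' => hf.map_rel t (hsub ht) t' (hsub ht'),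
      hf.const⟩

end Shifts

end OrderedFreeAmalg

namespace OrderedFreeAmalg

open FirstOrder FirstOrder.Language CategoryTheory

/-! ### Relational structures and the clique criterion for free amalgamation classes. -/

section ModelTheory

variable {L : FirstOrder.Language.{u, v}}

/-- `p(x)` in a `(σ₀ ⊎ {<})`-structure, for a unary symbol `p` of `σ₀`. -/
def Un {A : Type w} [(ordLang L).Structure A] (p : L.Relations 1) (x : A) : Prop :=
  Structure.RelMap ((LHom.sumInl : L →ᴸ ordLang L).onRelation p) ![x]

theorem relMap_one {M : Type*} [L.Structure M] (R : L.Relations 1) (t : Fin 1 → M) :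
    Structure.RelMap R t ↔ Structure.RelMap R ![t 0] := by
  rw [show t = ![t 0] from funext fun i => by fin_cases i; rfl]
  rfl

theorem relMap_two {M : Type*} [L.Structure M] (R : L.Relations 2) (t : Fin 2 → M) :
    Structure.RelMap R t ↔ Structure.RelMap R ![t 0, t 1] := by
  rw [show t = ![t 0, t 1] from funext fun i => by fin_cases i <;> rfl]
  rfl

/-- In a relational language with unary and binary symbols only, injections that preserve and
reflect these symbols are embeddings. -/
theorem exists_embedding_of_arity [L.IsRelational]
    (harity : ∀ n, Nonempty (L.Relations n) → n = 1 ∨ n = 2) {M N : Type*} [L.Structure M]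
    [L.Structure N] (f : M → N) (hf : Function.Injective f)
    (h₁ : ∀ (p : L.Relations 1) x, Structure.RelMap p ![f x] ↔ Structure.RelMap p ![x])
    (h₂ : ∀ (R : L.Relations 2) x y,
      Structure.RelMap R ![f x, f y] ↔ Structure.RelMap R ![x, y]) :
    ∃ e : M ↪[L] N, ∀ x, e x = f x := by
  refine ⟨⟨⟨f, hf⟩, fun g => isEmptyElim g, fun {n} R t => ?_⟩, fun _ => rfl⟩
  rcases harity n ⟨R⟩ with rfl | rfl
  · rw [relMap_one, relMap_one R t]
    exact h₁ R (t 0)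
  · rw [relMap_two, relMap_two R t]
    exact h₂ R (t 0) (t 1)

theorem arity_ordLang (harity : ∀ n, Nonempty (L.Relations n) → n = 1 ∨ n = 2) (n : ℕ)
    (h : Nonempty ((ordLang L).Relations n)) : n = 1 ∨ n = 2 := by
  obtain ⟨R | R⟩ := h
  · exact harity n ⟨R⟩
  · cases R
    exact Or.inr rfl

theorem exists_embedding_ordLang [L.IsRelational]
    (harity : ∀ n, Nonempty (L.Relations n) → n = 1 ∨ n = 2) {M N : Type*}
    [(ordLang L).Structure M] [(ordLang L).Structure N] (f : M → N) (hf : Function.Injective f)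
    (h₁ : ∀ (p : L.Relations 1) x, Un p (f x) ↔ Un p x)
    (h₂ : ∀ (R : L.Relations 2) x y, Rel R (f x) (f y) ↔ Rel R x y)
    (h₃ : ∀ x y, Lt L (f x) (f y) ↔ Lt L x y) :
    ∃ e : M ↪[ordLang L] N, ∀ x, e x = f x := by
  refine exists_embedding_of_arity (arity_ordLang harity) f hf ?_ ?_
  · rintro (p | p) x
    · exact h₁ p x
    · cases p
  · rintro (R | R) x y
    · exact h₂ R x y
    · cases R
      exact h₃ x y

theorem relMap_embedding_one {M N : Type*} [L.Structure M] [L.Structure N] (e : M ↪[L] N)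
    (p : L.Relations 1) (x : M) : Structure.RelMap p ![e x] ↔ Structure.RelMap p ![x] := by
  rw [← e.map_rel, relMap_one p (e ∘ _)]
  rfl

theorem relMap_embedding_two {M N : Type*} [L.Structure M] [L.Structure N] (e : M ↪[L] N)
    (R : L.Relations 2) (x y : M) :
    Structure.RelMap R ![e x, e y] ↔ Structure.RelMap R ![x, y] := by
  rw [← e.map_rel, relMap_two R (e ∘ _)]
  rfl

/-- The substructure of a relational structure on a given set. -/
def subOn [L.IsRelational] (M : Type*) [L.Structure M] (W : Set M) : L.Substructure M :=
  ⟨W, fun f => isEmptyElim f⟩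

theorem relMap_subOn_one [L.IsRelational] {M : Type*} [L.Structure M] (W : Set M)
    (p : L.Relations 1) (x : subOn (L := L) M W) :
    Structure.RelMap p ![x] ↔ Structure.RelMap p ![(x : M)] :=
  (relMap_embedding_one (subOn (L := L) M W).subtype p x).symm

theorem relMap_subOn_two [L.IsRelational] {M : Type*} [L.Structure M] (W : Set M)
    (R : L.Relations 2) (x y : subOn (L := L) M W) :
    Structure.RelMap R ![x, y] ↔ Structure.RelMap R ![(x : M), (y : M)] :=
  (relMap_embedding_two (subOn (L := L) M W).subtype R x y).symm

/-- The set `Q` consists of pairwise related points. -/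
def IsClique {M : Type*} [L.Structure M] (Q : Set M) : Prop :=
  ∀ x ∈ Q, ∀ y ∈ Q, x ≠ y →
    ∃ R : L.Relations 2, Structure.RelMap R ![x, y] ∨ Structure.RelMap R ![y, x]

/-- A free amalgamation class contains every finite structure all of whose cliques it contains. -/
theorem IsFreeAmalgamationClass.mem_of_cliques [L.IsRelational]
    (harity : ∀ n, Nonempty (L.Relations n) → n = 1 ∨ n = 2)
    {K : Set (Bundled.{w} L.Structure)} (hK : IsFreeAmalgamationClass K)
    (X : Type w) [L.Structure X] [Finite X]
    (hX : ∀ Q : Set X, IsClique (L := L) Q → Bundled.mk (subOn (L := L) X Q) ∈ K) :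
    Bundled.mk X ∈ K := by
  classical
  have key : ∀ W : Set X, Bundled.mk (subOn (L := L) X W) ∈ K := by
    intro W
    induction W using WellFoundedLT.induction with
    | ind W ih =>
    by_cases hW : IsClique (L := L) W
    · exact hX W hW
    unfold IsClique at hW
    push Not at hW
    obtain ⟨x, hx, y, hy, hxy, hR⟩ := hW
    have hsub : ∀ V : Set X, ∀ z ∈ V, V \ {z} < V := fun V z hz =>
      ⟨Set.sdiff_subset, fun h => (h hz).2 rfl⟩
    have hMN : subOn (L := L) X ((W \ {x}) \ {y}) ≤ subOn X (W \ {x}) :=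
      fun z hz => hz.1
    have hMP : subOn (L := L) X ((W \ {x}) \ {y}) ≤ subOn X (W \ {y}) :=
      fun z hz => ⟨hz.1.1, hz.2⟩
    -- As `x` and `y` are unrelated and all symbols are at most binary, the structure on `W` is the
    -- free amalgam of those on `W \ {x}` and `W \ {y}` over their intersection; it suffices to
    -- embed it into `Q`.
    obtain ⟨Q, hQ, NQ, PQ, ham⟩ := hK.free_amalgamation (Bundled.mk (subOn (L := L) X ((W \ {x}) \ {y})))
      (Bundled.mk (subOn (L := L) X (W \ {x}))) (Bundled.mk (subOn (L := L) X (W \ {y})))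
      (Substructure.inclusion hMN) (Substructure.inclusion hMP)
      (ih _ ((hsub (W \ {x}) y ⟨hy, hxy.symm⟩).trans (hsub W x hx))) (ih _ (hsub W x hx)) (ih _ (hsub W y hy))
    let φ : subOn (L := L) X W → Q := fun z =>
      if h : (z : X) = x then PQ ⟨x, hx, hxy⟩ else NQ ⟨z, z.2, h⟩
    have hφN : ∀ (z : X) (hz : z ∈ W) (h : z ≠ x), φ ⟨z, hz⟩ = NQ ⟨z, hz, h⟩ :=
      fun z hz h => dif_neg h
    have hφP : ∀ (z : X) (hz : z ∈ W) (h : z ≠ y), φ ⟨z, hz⟩ = PQ ⟨z, hz, h⟩ := by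
      intro z hz h
      by_cases hzx : z = x
      · subst hzx
        exact dif_pos rfl
      · rw [hφN z hz hzx]
        exact ham.comm ⟨z, ⟨hz, hzx⟩, h⟩
    have hxN : φ ⟨x, hx⟩ ∉ Set.range NQ := by
      rintro ⟨n, hn⟩
      rw [hφP x hx hxy] at hn
      obtain ⟨m, -, hm⟩ := ham.overlap _ _ hn
      have : x = m := congrArg Subtype.val hm
      exact m.2.1.2 this.symm
    have hyP : φ ⟨y, hy⟩ ∉ Set.range PQ := by
      rintro ⟨n, hn⟩
      rw [hφN y hy hxy.symm] at hn
      obtain ⟨m, hm, -⟩ := ham.overlap _ _ hn.symm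
      have : y = m := congrArg Subtype.val hm
      exact m.2.2 this.symm
    have hφ : Function.Injective φ := by
      rintro ⟨a, ha⟩ ⟨b, hb⟩ hab
      refine Subtype.ext ?_
      by_cases hax : a = x
      · by_cases hbx : b = x
        · exact hax.trans hbx.symm
        · subst hax
          exact absurd ⟨_, (hφN b hb hbx).symm.trans hab.symm⟩ hxN
      · by_cases hbx : b = x
        · subst hbx
          exact absurd ⟨_, (hφN a ha hax).symm.trans hab⟩ hxN
        · rw [hφN a ha hax, hφN b hb hbx] at hab
          exact (Subtype.ext_iff.1 (NQ.injective hab) : a = b)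
    obtain ⟨e, -⟩ := exists_embedding_of_arity (L := L) harity φ hφ (fun p ⟨z, hz⟩ => by
      by_cases hzx : z = x
      · subst hzx
        rw [hφP z hz hxy]
        exact (relMap_embedding_one PQ p _).trans
          ((relMap_subOn_one _ p _).trans (relMap_subOn_one W p ⟨z, hz⟩).symm)
      · rw [hφN z hz hzx]
        exact (relMap_embedding_one NQ p _).trans
          ((relMap_subOn_one _ p _).trans (relMap_subOn_one W p ⟨z, hz⟩).symm)) (fun R ⟨a, ha⟩ ⟨b, hb⟩ => by
      by_cases hx' : a ≠ x ∧ b ≠ x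
      · rw [hφN a ha hx'.1, hφN b hb hx'.2]
        exact (relMap_embedding_two NQ R _ _).trans
          ((relMap_subOn_two _ R _ _).trans (relMap_subOn_two W R ⟨a, ha⟩ ⟨b, hb⟩).symm)
      by_cases hy' : a ≠ y ∧ b ≠ y
      · rw [hφP a ha hy'.1, hφP b hb hy'.2]
        exact (relMap_embedding_two PQ R _ _).trans
          ((relMap_subOn_two _ R _ _).trans (relMap_subOn_two W R ⟨a, ha⟩ ⟨b, hb⟩).symm)
      -- A pair contained in neither part consists of `x` and `y`, which are unrelated in `W` by
      -- choice and in `Q` by freeness.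
      have hab : (a = x ∧ b = y) ∨ (a = y ∧ b = x) := by
        by_cases h1 : a = x
        · by_cases h2 : b = y
          · exact Or.inl ⟨h1, h2⟩
          · exact absurd ⟨fun h => hxy (h1.symm.trans h), h2⟩ hy'
        · have h2 : b = x := by
            by_contra h2
            exact hx' ⟨h1, h2⟩
          refine Or.inr ⟨?_, h2⟩
          by_contra h3
          exact hy' ⟨h3, fun h => hxy (h2.symm.trans h)⟩
      refine iff_of_false (fun h => ?_) (fun h => ?_)
      · rcases hab with ⟨rfl, rfl⟩ | ⟨rfl, rfl⟩ <;> rcases ham.rel 2 R _ h with h' | h'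
        · exact hxN (h' 0)
        · exact hyP (h' 1)
        · exact hxN (h' 1)
        · exact hyP (h' 0)
      · have h' : Structure.RelMap R ![a, b] :=
          (relMap_subOn_two W R _ _).1 h
        rcases hab with ⟨rfl, rfl⟩ | ⟨rfl, rfl⟩
        · exact (hR R).1 h'
        · exact (hR R).2 h')
    exact hK.hereditary Q hQ ⟨Structure.FG.of_finite, ⟨e⟩⟩
  exact hK.hereditary _ (key Set.univ) ⟨Structure.FG.of_finite,
    ⟨⟨⟨fun x => ⟨x, trivial⟩, fun a b h => congrArg Subtype.val h⟩, fun f => isEmptyElim f,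
      fun _ _ => Iff.rfl⟩⟩⟩

/-- The `{<}`-structure given by a binary relation. -/
@[reducible] def ltStructure {X : Type w} (lt : X → X → Prop) : ltLang.Structure X where
  funMap f := f.elim
  RelMap | LtRel.lt, t => lt (t 0) (t 1)

theorem mk_mem_orderedExpansion {K : Set (Bundled.{w} L.Structure)} {X : Type w} [L.Structure X]
    (hX : Bundled.mk X ∈ K) (lt : X → X → Prop) [IsStrictTotalOrder X lt] :
    letI := ltStructure lt
    (⟨X, sumStructure L ltLang X⟩ : Bundled.{w} (ordLang L).Structure) ∈ orderedExpansion K :=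
  ⟨hX, ‹_›⟩

/-- The structure given by families of unary and of binary relations. -/
@[reducible] def relStructure [L.IsRelational] {X : Type w} (u : L.Relations 1 → X → Prop)
    (r : L.Relations 2 → X → X → Prop) : L.Structure X where
  funMap f := isEmptyElim f
  RelMap {n} := match n with
    | 1 => fun p t => u p (t 0)
    | 2 => fun R t => r R (t 0) (t 1)
    | _ => fun _ _ => False

/-! ### The Fraïssé limit: total order, orbits as types, realisation of extensions. -/

section Limit

variable [L.IsRelational] (harity : ∀ n, Nonempty (L.Relations n) → n = 1 ∨ n = 2)
  {K : Set (Bundled.{w} L.Structure)} {A : Type w} [(ordLang L).Structure A] [Countable A]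
  (hA : IsFraisseLimit (orderedExpansion K) A)

include hA

theorem mem_orderedExpansion_of_embedding (M : Bundled.{w} (ordLang L).Structure) [Finite M]
    (e : M ↪[ordLang L] A) : M ∈ orderedExpansion K := by
  rw [← hA.age]
  exact ⟨Structure.FG.of_finite, ⟨e⟩⟩

theorem subOn_mem_orderedExpansion (W : Set A) (hW : W.Finite) :
    Bundled.mk (subOn (L := ordLang L) A W) ∈ orderedExpansion K := by
  have : Finite (subOn (L := ordLang L) A W) := hW
  exact @mem_orderedExpansion_of_embedding _ _ _ _ _ _ hA
    (Bundled.mk (subOn (L := ordLang L) A W)) this (subOn (L := ordLang L) A W).subtype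

/-- The axioms concern at most three points at a time, and the finite substructures of `A` belong to
the class. -/
theorem isStrictTotalOrder_lt : IsStrictTotalOrder A (Lt L) := by
  have key : ∀ x y z : A, (¬ Lt L x x) ∧ (Lt L x y → Lt L y z → Lt L x z) ∧
      (¬ Lt L x y → ¬ Lt L y x → x = y) := by
    intro x y z
    have h := (subOn_mem_orderedExpansion hA {x, y, z} (by simp)).2
    have hlt : ∀ a b : subOn (L := ordLang L) A {x, y, z}, Lt L a b ↔ Lt L (a : A) (b : A) :=
      relMap_subOn_two (L := ordLang L) {x, y, z} _
    let x' : subOn (L := ordLang L) A {x, y, z} := ⟨x, Or.inl rfl⟩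
    let y' : subOn (L := ordLang L) A {x, y, z} := ⟨y, Or.inr (Or.inl rfl)⟩
    let z' : subOn (L := ordLang L) A {x, y, z} := ⟨z, Or.inr (Or.inr rfl)⟩
    refine ⟨fun hx => h.irrefl x' ((hlt x' x').2 hx), fun h1 h2 =>
      (hlt x' z').1 (h.trans x' y' z' ((hlt x' y').2 h1) ((hlt y' z').2 h2)), fun h1 h2 => ?_⟩
    have := h.trichotomous x' y' (fun h => h1 ((hlt x' y').1 h)) (fun h => h2 ((hlt y' x').1 h))
    exact congrArg Subtype.val this
  exact
    { irrefl := fun x => (key x x x).1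
      trans := fun x y z => (key x y z).2.1
      trichotomous := fun x y => (key x y x).2.2 }

theorem rel_irrefl (hirr : IsIrreflexiveClass K) (R : L.Relations 2) (x : A) : ¬ Rel R x x := by
  have h := (subOn_mem_orderedExpansion hA {x} (by simp)).1
  intro hx
  exact hirr _ h R ⟨x, rfl⟩ ((relMap_subOn_two (L := ordLang L) {x} _ ⟨x, rfl⟩ ⟨x, rfl⟩).2 hx)

include harity

/-- Finite structures that map injectively to the limit, preserving and reflecting the relations
other than the order, are in the class. -/
theorem mem_of_map (Y : Type w) [L.Structure Y] [Finite Y] (h : Y → A)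
    (hh : Function.Injective h) (h₁ : ∀ (p : L.Relations 1) x,
      Un p (h x) ↔ Structure.RelMap p ![x])
    (h₂ : ∀ (R : L.Relations 2) x y, Rel R (h x) (h y) ↔ Structure.RelMap R ![x, y]) :
    Bundled.mk Y ∈ K := by
  let _ := ltStructure fun x y : Y => Lt L (h x) (h y)
  obtain ⟨e, -⟩ := exists_embedding_ordLang (L := L) harity h hh h₁ h₂ fun _ _ => Iff.rfl
  exact (mem_orderedExpansion_of_embedding hA ⟨Y, sumStructure L ltLang Y⟩ e).1

variable [LinearOrder A] (hlt : ∀ x y : A, x < y ↔ Lt L x y)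

include hlt

/-- Neither `p` nor `q` need be injective: equality of entries can be read off the order, so `p x ↦
q x` is a well-defined embedding of a finite substructure, which extends by homogeneity. -/
theorem exists_equiv_of_sameType {X : Type*} [Finite X] {p q : X → A}
    (h : SameType (fun p x => Un (L := L) p x) (fun R x y => Rel (L := L) R x y) ∅ p q) :
    ∃ π : A ≃[ordLang L] A, ∀ x, π (p x) = q x := by
  have hpq : ∀ x y, p x = p y ↔ q x = q y := by
    intro x y
    have h1 := h.lt x y
    have h2 := h.lt y x
    rw [eq_iff_le_not_lt, eq_iff_le_not_lt, ← not_lt, ← not_lt, h1, h2]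
  let W := subOn (L := ordLang L) A (Set.range p)
  have hW : Finite W := Set.finite_range p
  choose c hc using fun y : W => (show ∃ x, p x = y from y.2)
  obtain ⟨e, he⟩ := exists_embedding_ordLang (M := W) (N := A) harity (fun y => q (c y))
    (fun y y' hy => Subtype.ext (by rw [← hc y, ← hc y']; exact (hpq _ _).2 hy))
    (fun s y => by
      rw [h.unary s (c y)]
      rw [hc y]
      exact (relMap_subOn_one (L := ordLang L) _ _ y).symm)
    (fun R y y' => by
      rw [h.binary R (c y) (c y')]
      rw [hc y, hc y']
      exact (relMap_subOn_two (L := ordLang L) _ _ y y').symm)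
    (fun y y' => by
      rw [← hlt, h.lt, hc y, hc y', hlt]
      exact (relMap_subOn_two (L := ordLang L) _ _ y y').symm)
  obtain ⟨π, hπ⟩ := hA.ultrahomogeneous W Substructure.FG.of_finite e
  refine ⟨π, fun x => ?_⟩
  have h1 : e ⟨p x, x, rfl⟩ = π (p x) := by rw [hπ]; rfl
  rw [← h1, he]
  exact (hpq _ _).1 (hc ⟨p x, x, rfl⟩)

/-- By homogeneity, tuples of the same type are conjugate; joining `S` to both tuples forces the
automorphism to fix `S`. -/
theorem orbit_eq {I : Type*} [Finite I] (S : Finset A) (o : I → A) :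
    orbit L S o = {a | SameType (fun p x => Un (L := L) p x)
      (fun R x y => Rel (L := L) R x y) (S : Set A) o a} := by
  ext a
  constructor
  · rintro ⟨π, hS, ha⟩
    have hU : ∀ (p : L.Relations 1) x, Un p (π x) ↔ Un p x := fun p x =>
      relMap_embedding_one π.toEmbedding _ x
    have hR : ∀ (R : L.Relations 2) x y, Rel R (π x) (π y) ↔ Rel R x y := fun R x y =>
      relMap_embedding_two π.toEmbedding _ x y
    have hL : ∀ x y, π x < π y ↔ x < y := fun x y => by
      rw [hlt, hlt]
      exact relMap_embedding_two π.toEmbedding _ x y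
    obtain rfl : a = fun i => π (o i) := funext ha
    refine ⟨fun p i => hU p _, fun R i j => hR R _ _, fun i j => hL _ _, fun R s hs i => ?_,
      fun R s hs i => ?_, fun s hs i => ?_, fun s hs i => ?_⟩
    · simpa only [hS s hs] using hR R s (o i)
    · simpa only [hS s hs] using hR R (o i) s
    · simpa only [hS s hs] using hL s (o i)
    · simpa only [hS s hs] using hL (o i) s
  · intro h
    obtain ⟨π, hπ⟩ := exists_equiv_of_sameType harity hA hlt (X := S ⊕ I)
      (p := Sum.elim Subtype.val o) (q := Sum.elim Subtype.val a)
      { unary := by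
          rintro p (s | i)
          · exact Iff.rfl
          · exact h.unary p i
        binary := by
          rintro R (s | i) (s' | j)
          · exact Iff.rfl
          · exact h.left R s s.2 j
          · exact h.right R s' s'.2 i
          · exact h.binary R i j
        lt := by
          rintro (s | i) (s' | j)
          · exact Iff.rfl
          · exact h.lt_left s s.2 j
          · exact h.lt_right s' s'.2 i
          · exact h.lt i j
        left := by simp
        right := by simp
        lt_left := by simp
        lt_right := by simp }
    exact ⟨π, fun s hs => hπ (Sum.inl ⟨s, hs⟩), fun i => (hπ (Sum.inr i)).symm⟩

/-- The clique criterion puts the unordered extension in `K`, so with its order it embeds into `A`.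
An automorphism then takes the image of `T` back to `T`. -/
theorem hasRealizations (hK : IsFreeAmalgamationClass K) (hirr : IsIrreflexiveClass K) :
    HasRealizations.{w, x} (fun p x => Un (L := L) (A := A) p x)
      (fun R x y => Rel (L := L) (A := A) R x y) := by
  intro X _ _ u r T s hr hsu hsr hs hcl
  -- A copy of `X` in the universe of the structures in `K`.
  let X' : Type w := ULift.{w} (Fin (Nat.card X))
  let η : X' ≃ X := Equiv.ulift.trans (Finite.equivFin X).symm
  let _ : L.Structure X' := relStructure (fun p x => u p (η x)) fun R x y => r R (η x) (η y)
  have hX' : Bundled.mk X' ∈ K := by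
    refine hK.mem_of_cliques harity X' fun Q hQ => ?_
    obtain ⟨h, hU, hR⟩ := hcl (η '' Q) (by
      rintro _ ⟨x, hx, rfl⟩ _ ⟨y, hy, rfl⟩ hxy
      exact hQ x hx y hy fun h => hxy (h ▸ rfl))
    have hmem : ∀ y : subOn (L := L) X' Q, η (y : X') ∈ η '' Q := fun y => ⟨y, y.2, rfl⟩
    refine mem_of_map harity hA (subOn (L := L) X' Q) (fun y => h (η (y : X'))) ?_ ?_ ?_
    -- Two distinct points of a clique with the same image would yield a point related to itself.
    · intro y y' hyy
      by_contra hne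
      have hne' : (y : X') ≠ y' := fun h => hne (Subtype.ext h)
      have hne'' : η (y : X') ≠ η (y' : X') := fun h => hne' (η.injective h)
      have hyy' : h (η (y : X')) = h (η (y' : X')) := hyy
      obtain ⟨R, h' | h'⟩ := hQ y y.2 y' y'.2 hne'
      · have := (hR R _ (hmem y) _ (hmem y') hne'').2 h'
        rw [hyy'] at this
        exact rel_irrefl hA hirr R _ this
      · have := (hR R _ (hmem y') _ (hmem y) hne''.symm).2 h'
        rw [hyy'] at this
        exact rel_irrefl hA hirr R _ this
    · intro p y
      exact (hU p _ (hmem y)).trans (relMap_subOn_one Q p y).symm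
    · intro R y y'
      refine Iff.trans ?_ (relMap_subOn_two Q R y y').symm
      by_cases hyy : y = y'
      · subst hyy
        exact iff_of_false (rel_irrefl hA hirr R _) (hr R _)
      · exact hR R _ (hmem y) _ (hmem y') fun h => hyy (Subtype.ext (η.injective h))
  have horder : IsStrictTotalOrder X' (fun x y => η x < η y) := by
    exact
      { irrefl := fun x => lt_irrefl _
        trans := fun x y z => lt_trans
        trichotomous := fun x y h h' => η.injective (le_antisymm (not_lt.1 h') (not_lt.1 h)) }
  let _ := ltStructure fun x y : X' => η x < η y
  have hmem : (⟨X', sumStructure L ltLang X'⟩ : Bundled.{w} (ordLang L).Structure) ∈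
      orderedExpansion K := mk_mem_orderedExpansion hX' _
  rw [← hA.age] at hmem
  obtain ⟨-, ⟨e⟩⟩ := hmem
  have heU : ∀ p x, Un p (e x) ↔ u p (η x) := fun p x => relMap_embedding_one e _ x
  have heR : ∀ R x y, Rel R (e x) (e y) ↔ r R (η x) (η y) :=
    fun R x y => relMap_embedding_two e _ x y
  have heL : ∀ x y, e x < e y ↔ η x < η y :=
    fun x y => (hlt _ _).trans (relMap_embedding_two e _ x y)
  obtain ⟨π, hπ⟩ := exists_equiv_of_sameType harity hA hlt (X := T)
    (p := fun x => e (η.symm (s x))) (q := Subtype.val)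
    { unary := fun p x => by rw [heU, η.apply_symm_apply, hsu]
      binary := fun R x y => by rw [heR, η.apply_symm_apply, η.apply_symm_apply, hsr]
      lt := fun x y => by
        rw [heL, η.apply_symm_apply, η.apply_symm_apply, hs.lt_iff_lt]
        exact Iff.rfl
      left := by simp
      right := by simp
      lt_left := by simp
      lt_right := by simp }
  refine ⟨fun x => π (e (η.symm x)), fun x y hxy => ?_, hπ, fun p x => ?_, fun R x y => ?_⟩
  · rw [hlt]
    refine (relMap_embedding_two π.toEmbedding _ _ _).2 ((hlt _ _).1 ((heL _ _).2 ?_))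
    rwa [η.apply_symm_apply, η.apply_symm_apply]
  · refine (relMap_embedding_one π.toEmbedding _ _).trans ((heU _ _).trans ?_)
    rw [η.apply_symm_apply]
  · refine (relMap_embedding_two π.toEmbedding _ _ _).trans ((heR _ _ _).trans ?_)
    rw [η.apply_symm_apply, η.apply_symm_apply]

end Limit

end ModelTheory

end OrderedFreeAmalg

namespace OrderedFreeAmalg

/-! ### From partial duos varying in all coordinates to duos. -/

section Duos

variable {L : FirstOrder.Language.{u, v}} {A : Type w} [(ordLang L).Structure A] [LinearOrder A]
  {I : Type*} [LinearOrder I] [Fintype I]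

/-- Between distinct coordinates, all conditions hold because mixed tuples have the type of `o`. At
a single coordinate, `FreeLt` gives the order, and together with irreflexivity it makes all
relations fail. -/
theorem PartialDuo.isDuo (hlt : ∀ x y : A, x < y ↔ Lt L x y)
    (hirr : ∀ (R : L.Relations 2) (x : A), ¬ Rel R x x) {S : Set A} {o : I → A}
    (ho : StrictMono o) {a b : I → A}
    (hab : PartialDuo {t | SameType (fun p x => Un (L := L) p x)
      (fun R x y => Rel (L := L) R x y) S o t}
      (FreeLt fun R x y => Rel (L := L) R x y) Finset.univ a b) :
    IsDuo L {t | SameType (fun p x => Un (L := L) p x)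
      (fun R x y => Rel (L := L) R x y) S o t} a b := by
  have ha := hab.mix a fun _ => Or.inl rfl
  have hb := hab.mix b fun _ => Or.inr rfl
  have hmix : ∀ i, SameType (fun p x => Un (L := L) p x) (fun R x y => Rel (L := L) R x y) S o
      (Function.update a i (b i)) := by
    refine fun i => hab.mix _ fun j => ?_
    by_cases hj : j = i
    · subst hj
      simp
    · simp [hj]
  refine ⟨ha, hb, fun i => (hlt _ _).1 (hab.on i (Finset.mem_univ i)).1, fun i j hij => ?_,
    fun R i j => ?_, fun R i j => (ha.binary R i j).trans (hb.binary R i j).symm,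
    fun R i j => ?_⟩
  · have := (hmix i).strictMono ho hij
    rw [Function.update_self, Function.update_of_ne hij.ne'] at this
    exact (hlt _ _).1 this
  · by_cases hij : i = j
    · subst hij
      exact iff_of_false ((hab.on i (Finset.mem_univ i)).2 R).1 (hirr R _)
    · have := ((hmix j).binary R i j).trans (ha.binary R i j).symm
      rwa [Function.update_self, Function.update_of_ne hij] at this
  · by_cases hij : i = j
    · subst hij
      exact iff_of_false (hirr R _) ((hab.on i (Finset.mem_univ i)).2 R).2
    · have := ((hmix i).binary R i j).trans (hb.binary R i j).symm
      rw [Function.update_self, Function.update_of_ne (Ne.symm hij)] at this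
      exact this.symm

variable (E : Type*) [AddCommGroup E]

/-- The formal expression of a duo, as an additive map of the coefficient. -/
noncomputable def cogHom (a b : I → A) : E →+ ((I → A) →₀ E) :=
  ∑ J : Finset I, (Finsupp.singleAddHom (J.piecewise b a)).comp
    (zsmulAddGroupHom ((-1 : ℤ) ^ J.card))

omit [LinearOrder A] in
theorem cogHom_apply (a b : I → A) (l : E) :
    cogHom E a b l = ∑ J : Finset I, Finsupp.single (J.piecewise b a) ((-1 : ℤ) ^ J.card • l) := by
  simp [cogHom]

end Duos

end OrderedFreeAmalg

/-! ### The theorem. -/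

theorem theorem8p2
    -- a finite vocabulary of unary and binary relations
    (L : FirstOrder.Language.{u, v}) [L.IsRelational]
    (hfin : ∀ n, Finite (L.Relations n))
    (harity : ∀ n, Nonempty (L.Relations n) → n = 1 ∨ n = 2)
    -- a free amalgamation class of finite irreflexive structures
    (K : Set (CategoryTheory.Bundled.{w} L.Structure))
    (hK : OrderedFreeAmalg.IsFreeAmalgamationClass K)
    (hirr : OrderedFreeAmalg.IsIrreflexiveClass K)
    -- the limit of the class of all total orderings of its members
    (A : Type w) [(OrderedFreeAmalg.ordLang L).Structure A] [Countable A]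
    (hA : FirstOrder.Language.IsFraisseLimit (OrderedFreeAmalg.orderedExpansion K) A)
    -- an ordered orbit
    (S : Finset A) (I : Type*) [LinearOrder I] [Fintype I]
    (O : Set (I → A)) (hO : OrderedFreeAmalg.IsOrderedOrbit L S O)
    -- the coefficients
    (F : Type*) [Field F] (n : ℕ) (E : Submodule F (Fin n → F))
    (v : (I → A) →₀ E) (hv : v ∈ OrderedFreeAmalg.BLin F E O) :
    ∃ c : {p : (I → A) × (I → A) // OrderedFreeAmalg.IsDuo L O p.1 p.2} →₀ E,
      v = c.sum (fun p l => OrderedFreeAmalg.cog p.1.1 p.1.2 l) := by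
  classical
  open OrderedFreeAmalg in
  have hsto := isStrictTotalOrder_lt hA
  let _ : LinearOrder A := linearOrderOfSTO (Lt L)
  have hlt : ∀ x y : A, x < y ↔ Lt L x y := fun _ _ => Iff.rfl
  have hirrA := rel_irrefl hA hirr
  obtain ⟨o, ⟨hoS, ho⟩, rfl⟩ := hO
  have homono : StrictMono o := fun i j hij => ho i j hij
  rw [orbit_eq harity hA hlt] at hv ⊢
  obtain ⟨hsupp, hbal⟩ := Submodule.mem_inf.1 hv
  rw [Submodule.mem_iInf] at hbal
  have hspan := mem_cogSpan_of_balanced hirrA (hasRealizations harity hA hlt hK hirr) S homono hoS v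
    (fun t ht => hsupp ht) (fun i => hbal i)
  let Φ := Finsupp.liftAddHom (M := E) fun p : {p : (I → A) × (I → A) // IsDuo L
    {t | SameType (fun p x => Un (L := L) p x) (fun R x y => Rel (L := L) R x y) (S : Set A) o t}
      p.1 p.2} => cogHom E p.1.1 p.1.2
  -- The generators carry arbitrary coefficients in `E`, so the additive span suffices; the range of
  -- `Φ` is a subgroup, and only the generators have to be checked.
  have hle : v ∈ Φ.range := by
    refine (AddSubgroup.closure_le _).2 ?_ hspan
    rintro w ⟨a, b, l, hab, rfl⟩
    refine ⟨Finsupp.single ⟨(a, b), hab.isDuo hlt hirrA homono⟩ l, ?_⟩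
    rw [Finsupp.liftAddHom_apply_single, cogHom_apply, partialCog, Finset.powerset_univ]
  obtain ⟨c, hc⟩ := hle
  refine ⟨c, ?_⟩
  rw [← hc, Finsupp.liftAddHom_apply]
  exact Finsupp.sum_congr fun p _ => cogHom_apply E _ _ _
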